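/- Let $n\ge 2$ and let $\Omega\subset\mathbb{C}^n$ be a bounded complete Reinhardt domain, i.e. a nonempty connected open bounded set such that $z\in\Omega$ and $|w_j|\le|z_j|$ for all $j$ imply $w\in\Omega$. Suppose that $\Omega$ has smooth boundary and let $\rho$ be a smooth multi-radial defining function for $\Omega$: $\rho$ is a real-valued $C^\infty$ function on an open neighbourhood $U$ of $\overline\Omega$ that depends only on $|z_1|,\dots,|z_n|$, $\Omega=\{z\in U:\rho(z)<0\}$, and $d\rho\neq0$ at every point of $\partial\Omega$. Put $\lambda=\exp(1/\rho)$ on $\Omega$, let $L^p(\Omega,\lambda)$ be the $L^p$ space of the measure $\lambda\,dV$ on $\Omega$, where $dV$ is Lebesgue measure, and let the weighted Bergman projection $\mathbf{B}_\Omega^\lambda$ be the orthogonal projection of $L^2(\Omega,\lambda)$ onto its closed subspace of holomorphic functions. Let $1<p<\infty$. Then $\mathbf{B}_\Omega^\lambda$ is bounded on $L^p(\Omega,\lambda)$, meaning that there is a constant $C$ with $\|\mathbf{B}_\Omega^\lambda f\|_{L^p(\Omega,\lambda)}\le C\,\|f\|_{L^p(\Omega,\lambda)}$ for all $f\in L^2(\Omega,\lambda)\cap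 L^p(\Omega,\lambda)$, if and only if $p=2$. -/

import Mathlib

open MeasureTheory Filter Topology
open scoped ENNReal NNReal ContDiff

/-- The measure `w dV` on `Ω ⊆ ℂⁿ`, where `dV` is Lebesgue measure. -/
noncomputable def weightedMeasure {n : ℕ} (Ω : Set (Fin n → ℂ)) (w : (Fin n → ℂ) → ℝ) :
    Measure (Fin n → ℂ) :=
  (volume.restrict Ω).withDensity fun z => ENNReal.ofReal (w z)

/-- `w` is a positive continuous weight on the open set `Ω`. -/
structure IsWeight {n : ℕ} (Ω : Set (Fin n → ℂ)) (w : (Fin n → ℂ) → ℝ) : Prop where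
  isOpen : IsOpen Ω
  continuousOn : ContinuousOn w Ω
  pos : ∀ z ∈ Ω, 0 < w z

/-- The weighted Bergman space `L²_a(Ω, w)`: the classes in `L²(Ω, w)` that have a representative
which is holomorphic on `Ω`. -/
noncomputable def bergmanSpace {n : ℕ} (Ω : Set (Fin n → ℂ)) (w : (Fin n → ℂ) → ℝ) :
    Submodule ℂ (Lp ℂ 2 (weightedMeasure Ω w)) where
  carrier := {f | ∃ g : (Fin n → ℂ) → ℂ, DifferentiableOn ℂ g Ω ∧ f =ᵐ[weightedMeasure Ω w] g}
  zero_mem' := ⟨0, differentiableOn_const 0, Lp.coeFn_zero _ _ _⟩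
  add_mem' := by
    rintro a b ⟨g, hg, ha⟩ ⟨h, hh, hb⟩
    exact ⟨g + h, hg.add hh, (Lp.coeFn_add a b).trans (ha.add hb)⟩
  smul_mem' := by
    rintro c a ⟨g, hg, ha⟩
    exact ⟨c • g, hg.const_smul c, (Lp.coeFn_smul c a).trans (ha.const_smul c)⟩

/-- Sub-mean value inequality for holomorphic functions on polydiscs. -/
theorem enorm_mul_volume_closedBall_le {n : ℕ} {g : (Fin n → ℂ) → ℂ} {z : Fin n → ℂ} {r : ℝ}
    {Ω : Set (Fin n → ℂ)} (hg : DifferentiableOn ℂ g Ω) (hr : Metric.closedBall z r ⊆ Ω) :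
    ‖g z‖ₑ * volume (Metric.closedBall z r) ≤ ∫⁻ v in Metric.closedBall z r, ‖g v‖ₑ := by
  classical
  set B : Set (Fin n → ℂ) := Metric.closedBall 0 r with hB
  have hBm : MeasurableSet B := Metric.isClosed_closedBall.measurableSet
  have hmem : ∀ v ∈ B, z + v ∈ Ω := fun v hv => hr (by simpa [hB] using hv)
  set G : (Fin n → ℂ) → ℂ := B.piecewise (fun v => g (z + v)) 0 with hG
  have hGm : Measurable G := by
    refine ContinuousOn.measurable_piecewise ?_ continuousOn_const hBm
    exact hg.continuousOn.comp (by fun_prop) hmem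
  have hc : Measurable fun q : (Fin n → ℂ) × ℝ => circleMap 0 1 q.2 • q.1 := by fun_prop
  have hrot : ∀ θ : ℝ, ∫⁻ v, ‖G (circleMap 0 1 θ • v)‖ₑ = ∫⁻ v, ‖G v‖ₑ := by
    intro θ
    have h := volume_preserving_pi (ι := Fin n)
      (fun _ => (rotation (Circle.exp θ)).measurePreserving)
    have := h.lintegral_comp (f := fun v => ‖G v‖ₑ) hGm.enorm
    rw [← this]
    refine lintegral_congr fun v => ?_
    congr 2
    ext i
    simp [circleMap]
  have hpt : ∀ v ∈ B, ENNReal.ofReal (2 * Real.pi) * ‖g z‖ₑ ≤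
      ∫⁻ θ in Set.Ioc 0 (2 * Real.pi), ‖G (circleMap 0 1 θ • v)‖ₑ := by
    intro v hv
    have hcl : closure (Metric.ball (0 : ℂ) |1|) = Metric.closedBall 0 1 := by
      rw [closure_ball _ (by norm_num)]; simp
    have hin : ∀ c ∈ Metric.closedBall (0 : ℂ) 1, c • v ∈ B := by
      intro c hc
      simp only [hB, Metric.mem_closedBall, dist_zero_right] at *
      rw [norm_smul]
      nlinarith [norm_nonneg v, norm_nonneg c]
    have hd : DiffContOnCl ℂ (fun c : ℂ => g (z + c • v)) (Metric.ball 0 |1|) := by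
      apply DifferentiableOn.diffContOnCl
      rw [hcl]
      exact hg.comp (by fun_prop) fun c hc => hmem _ (hin c hc)
    have hav := hd.circleAverage
    have hpi : (0 : ℝ) < 2 * Real.pi := by positivity
    rw [Real.circleAverage, intervalIntegral.integral_of_le hpi.le] at hav
    have : ∫ θ in Set.Ioc 0 (2 * Real.pi), G (circleMap 0 1 θ • v) = ((2 * Real.pi : ℝ) : ℂ) * g z := by
      have e : g z = g (z + (0 : ℂ) • v) := by simp
      rw [e, ← hav]
      have : ∀ θ : ℝ, G (circleMap 0 1 θ • v) = g (z + circleMap 0 1 θ • v) := by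
        intro θ
        rw [hG, Set.piecewise_eq_of_mem]
        exact hin _ (by simp)
      simp only [this, Complex.real_smul]
      rw [← mul_assoc, ← Complex.ofReal_mul, mul_inv_cancel₀ hpi.ne']
      simp
    calc _ = ‖((2 * Real.pi : ℝ) : ℂ) * g z‖ₑ := by
            rw [enorm_mul, ← ofReal_norm ((2 * Real.pi : ℝ) : ℂ), Complex.norm_real,
              Real.norm_of_nonneg hpi.le]
      _ ≤ _ := by rw [← this]; exact enorm_integral_le_lintegral_enorm _
  have hpi : (0 : ℝ) < 2 * Real.pi := by positivity
  have h1 : ENNReal.ofReal (2 * Real.pi) * (‖g z‖ₑ * volume B) ≤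
      ENNReal.ofReal (2 * Real.pi) * ∫⁻ v, ‖G v‖ₑ := by
    calc _ = ∫⁻ v in B, ENNReal.ofReal (2 * Real.pi) * ‖g z‖ₑ := by
            rw [setLIntegral_const, mul_assoc]
      _ ≤ ∫⁻ v in B, ∫⁻ θ in Set.Ioc 0 (2 * Real.pi), ‖G (circleMap 0 1 θ • v)‖ₑ :=
            setLIntegral_mono' hBm hpt
      _ ≤ ∫⁻ v, ∫⁻ θ in Set.Ioc 0 (2 * Real.pi), ‖G (circleMap 0 1 θ • v)‖ₑ :=
            setLIntegral_le_lintegral _ _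
      _ = ∫⁻ θ in Set.Ioc 0 (2 * Real.pi), ∫⁻ v, ‖G (circleMap 0 1 θ • v)‖ₑ :=
            lintegral_lintegral_swap (hGm.comp hc).enorm.aemeasurable
      _ = _ := by simp only [hrot]; rw [setLIntegral_const, Real.volume_Ioc, sub_zero, mul_comm]
  have h2 := (ENNReal.mul_le_mul_iff_right (by simpa using hpi) ENNReal.ofReal_ne_top).1 h1
  have hV : volume (Metric.closedBall z r) = volume B := Measure.addHaar_closedBall_center _ _ _
  rw [hV]
  refine h2.trans (le_of_eq ?_)
  have hGi : ∀ v, ‖G v‖ₑ = (Metric.closedBall z r).indicator (fun u => ‖g u‖ₑ) (z + v) := by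
    intro v
    by_cases hv : v ∈ B
    · have : z + v ∈ Metric.closedBall z r := by simpa [hB] using hv
      simp [hG, hv, this]
    · have : z + v ∉ Metric.closedBall z r := by simpa [hB] using hv
      simp only [hG, hv, this, Set.piecewise_eq_of_notMem, Set.indicator_of_notMem,
        not_false_eq_true, Pi.zero_apply, enorm_zero]
  simp only [hGi]
  rw [lintegral_add_left_eq_self
    (fun v => (Metric.closedBall z r).indicator (fun u => ‖g u‖ₑ) v),
    lintegral_indicator Metric.isClosed_closedBall.measurableSet]

/-- Point evaluations of holomorphic functions are locally uniformly bounded by the norm of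
`L²(Ω, w)`. -/
theorem IsWeight.exists_enorm_le {n : ℕ} {Ω : Set (Fin n → ℂ)} {w : (Fin n → ℂ) → ℝ}
    (h : IsWeight Ω w) {z₀ : Fin n → ℂ} (hz₀ : z₀ ∈ Ω) :
    ∃ r > 0, ∃ K : ℝ≥0, Metric.ball z₀ r ⊆ Ω ∧ ∀ g : (Fin n → ℂ) → ℂ, DifferentiableOn ℂ g Ω →
      ∀ z ∈ Metric.ball z₀ r, ‖g z‖ₑ ≤ K * eLpNorm g 2 (weightedMeasure Ω w) := by
  obtain ⟨R, hR, hRΩ⟩ := Metric.nhds_basis_closedBall.mem_iff.1 (h.isOpen.mem_nhds hz₀)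
  set A := Metric.closedBall z₀ R with hA
  have hAm : MeasurableSet A := Metric.isClosed_closedBall.measurableSet
  obtain ⟨x, hxA, hx⟩ := (isCompact_closedBall z₀ R).exists_isMinOn
    ⟨z₀, Metric.mem_closedBall_self hR.le⟩ (h.continuousOn.mono hRΩ)
  set c : ℝ≥0∞ := ENNReal.ofReal (w x) with hc
  have hc0 : c ≠ 0 := by simpa [hc] using h.pos x (hRΩ hxA)
  have hct : c ≠ ⊤ := ENNReal.ofReal_ne_top
  have hle : c • volume.restrict A ≤ weightedMeasure Ω w := by
    calc c • volume.restrict A = (volume.restrict A).withDensity fun _ => c :=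
          (withDensity_const c).symm
      _ ≤ (volume.restrict A).withDensity fun z => ENNReal.ofReal (w z) := by
          refine withDensity_mono ?_
          filter_upwards [ae_restrict_mem hAm] with z hz
          exact ENNReal.ofReal_le_ofReal (hx hz)
      _ = (weightedMeasure Ω w).restrict A := by
          rw [weightedMeasure, restrict_withDensity hAm, Measure.restrict_restrict hAm,
            Set.inter_eq_left.2 hRΩ]
      _ ≤ _ := Measure.restrict_le_self
  have hle' : volume.restrict A ≤ c⁻¹ • weightedMeasure Ω w := by
    calc volume.restrict A = c⁻¹ • c • volume.restrict A := by
          rw [smul_smul, ENNReal.inv_mul_cancel hc0 hct, one_smul]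
      _ ≤ _ := by gcongr
  set V := volume (Metric.closedBall z₀ (R / 2)) with hV
  have hV0 : V ≠ 0 := (Metric.measure_closedBall_pos _ _ (by positivity)).ne'
  have hVt : V ≠ ⊤ := (isCompact_closedBall _ _).measure_lt_top.ne
  set D : ℝ≥0∞ := c⁻¹ ^ (1 / (2 : ℝ≥0∞).toReal) * volume A ^ (1 / (1 : ℝ≥0∞).toReal - 1 / (2 : ℝ≥0∞).toReal) with hD
  have hDt : D ≠ ⊤ := by
    refine ENNReal.mul_ne_top (ENNReal.rpow_ne_top_of_nonneg (by positivity) (by simpa using hc0))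
      (ENNReal.rpow_ne_top_of_nonneg (by norm_num) (isCompact_closedBall _ _).measure_lt_top.ne)
  have hKt : D / V ≠ ⊤ := ENNReal.div_ne_top hDt hV0
  refine ⟨R / 2, by positivity, (D / V).toNNReal,
    (Metric.ball_subset_closedBall.trans (Metric.closedBall_subset_closedBall (by linarith))).trans
      hRΩ, fun g hg z hz => ?_⟩
  rw [ENNReal.coe_toNNReal hKt, ← ENNReal.mul_div_right_comm, ENNReal.le_div_iff_mul_le (.inl hV0) (.inl hVt)]
  have hzA : Metric.closedBall z (R / 2) ⊆ A :=
    Metric.closedBall_subset_closedBall' (by have := Metric.mem_ball.1 hz; linarith)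
  have hgm : AEStronglyMeasurable g (volume.restrict A) :=
    (hg.continuousOn.mono hRΩ).aestronglyMeasurable hAm
  calc ‖g z‖ₑ * V = ‖g z‖ₑ * volume (Metric.closedBall z (R / 2)) := by
        rw [hV, Measure.addHaar_closedBall_center, Measure.addHaar_closedBall_center volume z]
    _ ≤ ∫⁻ v in Metric.closedBall z (R / 2), ‖g v‖ₑ :=
        enorm_mul_volume_closedBall_le hg (hzA.trans hRΩ)
    _ ≤ ∫⁻ v in A, ‖g v‖ₑ := lintegral_mono_set hzA
    _ = eLpNorm g 1 (volume.restrict A) := eLpNorm_one_eq_lintegral_enorm.symm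
    _ ≤ eLpNorm g 2 (volume.restrict A) * volume A ^ (1 / (1 : ℝ≥0∞).toReal - 1 / (2 : ℝ≥0∞).toReal) := by
        have := eLpNorm_le_eLpNorm_mul_rpow_measure_univ (p := 1) (q := 2) (by norm_num) hgm
        rwa [Measure.restrict_apply_univ] at this
    _ ≤ eLpNorm g 2 (c⁻¹ • weightedMeasure Ω w) * volume A ^ (1 / (1 : ℝ≥0∞).toReal - 1 / (2 : ℝ≥0∞).toReal) := by
        gcongr
    _ = eLpNorm g 2 (weightedMeasure Ω w) * D := by
        rw [eLpNorm_smul_measure_of_ne_top (by norm_num), hD, smul_eq_mul]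
        simp only [one_div, ENNReal.toReal_inv]
        ring
    _ = D * eLpNorm g 2 (weightedMeasure Ω w) := mul_comm _ _

/-- The weighted Bergman space of a positive continuous weight is closed in `L²(Ω, w)`. -/
theorem isClosed_bergmanSpace {n : ℕ} {Ω : Set (Fin n → ℂ)} {w : (Fin n → ℂ) → ℝ}
    (h : IsWeight Ω w) : IsClosed (bergmanSpace Ω w : Set (Lp ℂ 2 (weightedMeasure Ω w))) := by
  refine IsSeqClosed.isClosed fun u f hu huf => ?_
  choose g hg hug using hu
  have hcau : ∀ ε > 0, ∃ N, ∀ k ≥ N, ∀ l ≥ N, ‖u k - u l‖ < ε := by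
    intro ε hε
    obtain ⟨N, hN⟩ := Metric.cauchySeq_iff.1 huf.cauchySeq ε hε
    exact ⟨N, fun k hk l hl => by simpa [dist_eq_norm] using hN k hk l hl⟩
  have hloc : ∀ z₀ ∈ Ω, ∃ r > 0, ∃ K : ℝ≥0, Metric.ball z₀ r ⊆ Ω ∧
      ∀ k l, ∀ z ∈ Metric.ball z₀ r, ‖g k z - g l z‖ ≤ K * ‖u k - u l‖ := by
    intro z₀ hz₀
    obtain ⟨r, hr, K, hrΩ, hK⟩ := h.exists_enorm_le hz₀
    refine ⟨r, hr, K, hrΩ, fun k l z hz => ?_⟩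
    have h1 := hK (g k - g l) ((hg k).sub (hg l)) z hz
    have h2 : eLpNorm (g k - g l) 2 (weightedMeasure Ω w) = ‖u k - u l‖ₑ := by
      rw [Lp.enorm_def]
      exact eLpNorm_congr_ae ((hug k).sub (hug l) |>.symm.trans (Lp.coeFn_sub _ _).symm)
    rw [h2, Pi.sub_apply, enorm_eq_nnnorm, enorm_eq_nnnorm] at h1
    exact_mod_cast h1
  have hlim : ∀ z ∈ Ω, ∃ a, Tendsto (fun k => g k z) atTop (𝓝 a) := by
    intro z hz
    obtain ⟨r, hr, K, -, hK⟩ := hloc z hz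
    refine cauchySeq_tendsto_of_complete (Metric.cauchySeq_iff.2 fun ε hε => ?_)
    obtain ⟨N, hN⟩ := hcau (ε / (K + 1)) (by positivity)
    refine ⟨N, fun k hk l hl => ?_⟩
    rw [dist_eq_norm]
    have h1 := hK k l z (Metric.mem_ball_self hr)
    have h2 := (lt_div_iff₀ (by positivity)).1 (hN k hk l hl)
    nlinarith [norm_nonneg (u k - u l)]
  choose! G hG using hlim
  refine ⟨G, fun z₀ hz₀ => ?_, ?_⟩
  · obtain ⟨r, hr, K, hrΩ, hK⟩ := hloc z₀ hz₀
    set s := Metric.ball z₀ (r / 2) with hs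
    have hsub : ∀ z ∈ s, Metric.ball z (r / 2) ⊆ Metric.ball z₀ r := fun z hz =>
      Metric.ball_subset_ball' (by have := Metric.mem_ball.1 hz; linarith)
    have hsΩ : s ⊆ Ω := (Metric.ball_subset_ball (by linarith)).trans hrΩ
    have hdiff : ∀ k, ∀ z ∈ s, DifferentiableAt ℂ (g k) z := fun k z hz =>
      (hg k).differentiableAt (h.isOpen.mem_nhds (hsΩ hz))
    have hder : ∀ k l, ∀ z ∈ s,
        ‖fderiv ℂ (g k) z - fderiv ℂ (g l) z‖ ≤ 2 * (K * ‖u k - u l‖) / (r / 2) := by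
      intro k l z hz
      rw [← fderiv_sub (hdiff k z hz) (hdiff l z hz)]
      refine Complex.norm_fderiv_le_div_of_mapsTo_ball
        (((hg k).sub (hg l)).mono ((hsub z hz).trans hrΩ)) ?_ (by positivity)
      intro v hv
      rw [Metric.mem_closedBall, dist_eq_norm]
      have h1 := hK k l v (hsub z hz hv)
      have h2 := hK k l z (hsub z hz (Metric.mem_ball_self (by positivity)))
      calc _ ≤ ‖g k v - g l v‖ + ‖g k z - g l z‖ := norm_sub_le _ _
        _ ≤ _ := by linarith
    have huc : UniformCauchySeqOn (fun k => fderiv ℂ (g k)) atTop s := by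
      rw [Metric.uniformCauchySeqOn_iff]
      intro ε hε
      obtain ⟨N, hN⟩ := hcau (ε / (4 * (K + 1) / r)) (by positivity)
      refine ⟨N, fun k hk l hl z hz => ?_⟩
      rw [dist_eq_norm]
      refine (hder k l z hz).trans_lt ?_
      have h2 := (lt_div_iff₀ (by positivity)).1 (hN k hk l hl)
      refine lt_of_le_of_lt ?_ h2
      have : ‖u k - u l‖ * (4 * (K + 1) / r) - 2 * (K * ‖u k - u l‖) / (r / 2)
        = 4 * ‖u k - u l‖ / r := by field_simp; ring
      have : 0 ≤ 4 * ‖u k - u l‖ / r := by positivity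
      linarith
    have hlim' : ∀ z ∈ s, ∃ a, Tendsto (fun k => fderiv ℂ (g k) z) atTop (𝓝 a) := fun z hz =>
      cauchySeq_tendsto_of_complete (huc.cauchySeq hz)
    choose! G' hG' using hlim'
    exact (hasFDerivAt_of_tendstoUniformlyOn Metric.isOpen_ball
      (huc.tendstoUniformlyOn_of_tendsto hG') (fun k z hz => (hdiff k z hz).hasFDerivAt)
      (fun z hz => hG z (hsΩ hz))
      (Metric.mem_ball_self (by positivity))).differentiableAt.differentiableWithinAt
  · obtain ⟨ns, hns, hae⟩ := (tendstoInMeasure_of_tendsto_Lp huf).exists_seq_tendsto_ae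
    have hΩ : ∀ᵐ z ∂weightedMeasure Ω w, z ∈ Ω :=
      (withDensity_absolutelyContinuous _ _).ae_le (ae_restrict_mem h.isOpen.measurableSet)
    filter_upwards [hae, hΩ, ae_all_iff.2 hug] with z h1 h2 h3
    refine tendsto_nhds_unique h1 ?_
    simp only [h3]
    exact (hG z h2).comp hns.tendsto_atTop

/-- The weighted Bergman projection: the orthogonal projection of `L²(Ω, w)` onto the (closed)
subspace `L²_a(Ω, w)`, as an operator on `L²(Ω, w)`. -/
noncomputable def bergmanProjection {n : ℕ} {Ω : Set (Fin n → ℂ)} {w : (Fin n → ℂ) → ℝ}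
    (h : IsWeight Ω w) :
    Lp ℂ 2 (weightedMeasure Ω w) →L[ℂ] Lp ℂ 2 (weightedMeasure Ω w) :=
  haveI : CompleteSpace (bergmanSpace Ω w) := (isClosed_bergmanSpace h).completeSpace_coe
  (bergmanSpace Ω w).starProjection

/-- An operator `T` on `L²(μ)` is bounded on `L^p(μ)`: there is a constant `C` such that
`‖T f‖_p ≤ C ‖f‖_p` for all `f ∈ L²(μ) ∩ L^p(μ)`. For `p < ∞` the space `L² ∩ L^p` is dense in
`L^p`, so this says that `T` extends to a bounded operator on `L^p(μ)`. -/
def IsBoundedOnLp {X : Type*} [MeasurableSpace X] {μ : Measure X}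
    (T : Lp ℂ 2 μ →L[ℂ] Lp ℂ 2 μ) (p : ℝ≥0∞) : Prop :=
  ∃ C : ℝ≥0, ∀ f : Lp ℂ 2 μ, MemLp f p μ → eLpNorm (T f) p μ ≤ C * eLpNorm f p μ

/-- `Ω ⊆ ℂⁿ` is a complete Reinhardt domain. -/
structure IsCompleteReinhardtDomain {n : ℕ} (Ω : Set (Fin n → ℂ)) : Prop where
  isOpen : IsOpen Ω
  isConnected : IsConnected Ω
  mem_of_norm_le : ∀ z ∈ Ω, ∀ w : Fin n → ℂ, (∀ j, ‖w j‖ ≤ ‖z j‖) → w ∈ Ω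

/-- `ρ` is a smooth multi-radial defining function for `Ω`: on some open neighbourhood `U` of the
closure of `Ω` it is a real-valued `C^∞` function that depends only on `|z₁|, …, |zₙ|`, one has
`Ω = {z ∈ U | ρ z < 0}`, and `dρ ≠ 0` at every boundary point of `Ω`. A bounded domain has a smooth
boundary when it has a smooth defining function. -/
structure IsMultiRadialDefiningFunction {n : ℕ} (Ω : Set (Fin n → ℂ)) (ρ : (Fin n → ℂ) → ℝ) :
    Prop where
  exists_nhd : ∃ U : Set (Fin n → ℂ), IsOpen U ∧ closure Ω ⊆ U ∧ ContDiffOn ℝ ∞ ρ U ∧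
    Ω = {z | z ∈ U ∧ ρ z < 0} ∧ ∀ z ∈ U, ∀ w ∈ U, (∀ j, ‖z j‖ = ‖w j‖) → ρ z = ρ w
  fderiv_ne_zero : ∀ z ∈ frontier Ω, fderiv ℝ ρ z ≠ 0

/-- The exponential weight `exp (1 / ρ)` of a defining function `ρ` is positive and continuous. -/
theorem IsMultiRadialDefiningFunction.isWeight {n : ℕ} {Ω : Set (Fin n → ℂ)}
    {ρ : (Fin n → ℂ) → ℝ} (h : IsMultiRadialDefiningFunction Ω ρ) :
    IsWeight Ω fun z => Real.exp (1 / ρ z) := by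
  obtain ⟨U, hU, -, hρ, rfl, -⟩ := h.exists_nhd
  refine ⟨hρ.continuousOn.isOpen_inter_preimage hU isOpen_Iio, ?_, fun z _ => Real.exp_pos _⟩
  refine Real.continuous_exp.comp_continuousOn (continuousOn_const.div
    (hρ.continuousOn.mono fun z hz => hz.1) fun z hz => hz.2.ne)

/-!
Fix a coordinate `j`, let `R` be the supremum of `‖z j‖` on `Ω`, and let `A s` be the integral of
`‖z j‖ ^ s` against the weighted measure. The case `p = 2` is the contractivity of orthogonal
projections. For `p ≠ 2`, with conjugate exponent `q`, boundedness on `L^p` is refuted by two facts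
about the moments `A s`.

* Boundedness gives a constant `C` with
  `A (m * p) ^ (1 / p) * A (m * q) ^ (1 / q) ≤ C * A (m * 2)` for all positive integers `m`
  (`coordMoment_mul_le_of_isBoundedOnLp`). By the rotation invariance of the measure, the pairing
  of a holomorphic `G` with `z j ^ m` times a function of `‖z j‖` only depends on one Taylor
  coefficient of `G` (`IsTorusInvariant.exists_coeff`). Hence the rank one operator through the
  monomial `z j ^ m` inherits the `L^p` bound of the projection, and testing it on the extremal
  function for Hölder's inequality yields the estimate.
* With the weight `exp (1 / ρ)` the function `G s = -log (A s / R ^ s)` is of exact order `√s`.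
  Indeed `-ρ ≤ M * (R - ‖z j‖)` on `Ω`, and `-ρ` is comparable to `R - ‖z j‖` on balls that
  approach the boundary point on the `j`-th axis, where symmetry makes `dρ` radial
  (`exists_coordMoment_le`, `exists_le_coordMoment`).

Taking logarithms, `G (m * 2) ≤ G (m * p) / p + G (m * q) / q + C'`. Since
`√(1 / p) + √(1 / q) < √2`, this turns an eventual bound `G s ≤ β * √s` into `G s ≤ θ * β * √s`
with a fixed `θ < 1`. Iterating contradicts the lower bound for `G`
(`false_of_dilation_inequality`); no asymptotic constants are needed.
-/

/-! ### Rotation invariance and Taylor coefficients -/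

/-- `Ω` contains the coordinatewise rotations of its points, and these do not change the weight
`w`. -/
structure IsTorusInvariant {n : ℕ} (Ω : Set (Fin n → ℂ)) (w : (Fin n → ℂ) → ℝ) : Prop where
  mem : ∀ z ∈ Ω, ∀ u : Fin n → Circle, (fun i => (u i : ℂ) * z i) ∈ Ω
  weight : ∀ z ∈ Ω, ∀ u : Fin n → Circle, w (fun i => (u i : ℂ) * z i) = w z

theorem IsTorusInvariant.mem_iff {n : ℕ} {Ω : Set (Fin n → ℂ)} {w : (Fin n → ℂ) → ℝ}
    (h : IsTorusInvariant Ω w) (u : Fin n → Circle) (z : Fin n → ℂ) :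
    (fun i => (u i : ℂ) * z i) ∈ Ω ↔ z ∈ Ω := by
  refine ⟨fun hz => ?_, fun hz => h.mem z hz u⟩
  have := h.mem _ hz fun i => (u i)⁻¹
  simpa [← mul_assoc, Circle.coe_inv] using this

theorem IsTorusInvariant.measurePreserving {n : ℕ} {Ω : Set (Fin n → ℂ)} {w : (Fin n → ℂ) → ℝ}
    (h : IsTorusInvariant Ω w) (hΩ : MeasurableSet Ω) (u : Fin n → Circle) :
    MeasurePreserving (fun (z : Fin n → ℂ) i => (u i : ℂ) * z i) (weightedMeasure Ω w)
      (weightedMeasure Ω w) := by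
  set T : (Fin n → ℂ) → (Fin n → ℂ) := fun z i => (u i : ℂ) * z i with hT
  have hTm : Measurable T := by fun_prop
  have hvol : MeasurePreserving T volume volume :=
    volume_preserving_pi (ι := Fin n) (fun i => (rotation (u i)).measurePreserving)
  have hemb : MeasurableEmbedding T := by
    refine (by fun_prop : Continuous T).measurableEmbedding fun x y hxy => ?_
    ext i
    simpa [hT] using congrFun hxy i
  refine ⟨hTm, Measure.ext fun A hA => ?_⟩
  rw [Measure.map_apply hTm hA, weightedMeasure, withDensity_apply _ hA,
    withDensity_apply _ (hTm hA), Measure.restrict_restrict hA, Measure.restrict_restrict (hTm hA),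
    ← hvol.setLIntegral_comp_preimage_emb hemb _ (A ∩ Ω)]
  have hpre : T ⁻¹' (A ∩ Ω) = T ⁻¹' A ∩ Ω := by
    ext z
    simp only [Set.mem_preimage, Set.mem_inter_iff, hT, h.mem_iff u z]
  rw [hpre]
  refine setLIntegral_congr_fun ((hTm hA).inter hΩ) fun z hz => ?_
  simp only [hT, h.weight z hz.2 u]

instance {n : ℕ} (Ω : Set (Fin n → ℂ)) (w : (Fin n → ℂ) → ℝ) : SFinite (weightedMeasure Ω w) := by
  unfold weightedMeasure
  infer_instance

theorem ae_mem_weightedMeasure {n : ℕ} {Ω : Set (Fin n → ℂ)} (w : (Fin n → ℂ) → ℝ)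
    (hΩ : MeasurableSet Ω) : ∀ᵐ z ∂weightedMeasure Ω w, z ∈ Ω :=
  (withDensity_absolutelyContinuous _ _).ae_le (ae_restrict_mem hΩ)

/-- Integrals against a rotation invariant measure may be averaged over a circle of rotations. -/
theorem IsTorusInvariant.integral_average {n : ℕ} {Ω : Set (Fin n → ℂ)} {w : (Fin n → ℂ) → ℝ}
    (h : IsTorusInvariant Ω w) (hΩ : MeasurableSet Ω) {c : ℝ → Fin n → Circle}
    (hc : ∀ i, Continuous fun θ => c θ i) {H : (Fin n → ℂ) → ℂ}
    (hH : Integrable H (weightedMeasure Ω w)) :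
    Integrable (fun z => ∫ θ in (0 : ℝ)..2 * Real.pi, H fun i => (c θ i : ℂ) * z i)
        (weightedMeasure Ω w) ∧
      ∫ z, (∫ θ in (0 : ℝ)..2 * Real.pi, H fun i => (c θ i : ℂ) * z i) ∂weightedMeasure Ω w =
        2 * Real.pi * ∫ z, H z ∂weightedMeasure Ω w := by
  set μ := weightedMeasure Ω w
  set ν : Measure ℝ := volume.restrict (Set.Ioc 0 (2 * Real.pi))
  have hpi : (0 : ℝ) ≤ 2 * Real.pi := by positivity
  have hcm : Measurable (Function.uncurry fun (θ : ℝ) (z : Fin n → ℂ) (i : Fin n) =>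
      (c θ i : ℂ) * z i) := by
    refine Continuous.measurable (continuous_pi fun i => ?_)
    have := hc i
    fun_prop
  have hmp : MeasurePreserving (fun q : ℝ × (Fin n → ℂ) => (q.1, fun i => (c q.1 i : ℂ) * q.2 i))
      (ν.prod μ) (ν.prod μ) :=
    (MeasurePreserving.id ν).skew_product hcm
      (ae_of_all _ fun θ => (h.measurePreserving hΩ (c θ)).map_eq)
  have hint : Integrable (fun q : ℝ × (Fin n → ℂ) => H fun i => (c q.1 i : ℂ) * q.2 i)
      (ν.prod μ) := (hmp.integrable_comp_of_integrable (hH.comp_snd ν) :)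
  have hval : ∀ θ, ∫ z, H (fun i => (c θ i : ℂ) * z i) ∂μ = ∫ z, H z ∂μ := fun θ => by
    have hemb : MeasurableEmbedding fun (z : Fin n → ℂ) (i : Fin n) => (c θ i : ℂ) * z i := by
      refine (by fun_prop : Continuous _).measurableEmbedding fun x y hxy => ?_
      ext i
      simpa using congrFun hxy i
    exact (h.measurePreserving hΩ (c θ)).integral_comp hemb H
  simp only [intervalIntegral.integral_of_le hpi]
  refine ⟨hint.integral_prod_right, ?_⟩
  rw [← integral_prod_symm _ hint, integral_prod _ hint]
  simp only [hval]
  rw [integral_const]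
  simp [ν, Real.pi_pos.le]

/-- The Cauchy integral formula for the Taylor coefficients at the centre of the unit disc. -/
theorem integral_conj_circleMap_pow_mul {f : ℂ → ℂ}
    (hf : DifferentiableOn ℂ f (Metric.closedBall 0 1)) (m : ℕ) :
    ∫ θ in (0 : ℝ)..2 * Real.pi,
        f (Circle.exp θ) * (starRingEnd ℂ) (Circle.exp θ : ℂ) ^ m =
      2 * Real.pi * (iteratedDeriv m f 0 / m.factorial) := by
  have hd : DiffContOnCl ℂ f (Metric.ball 0 1) := by
    apply DifferentiableOn.diffContOnCl
    rwa [closure_ball _ one_ne_zero]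
  have h := hd.circleIntegral_one_div_sub_center_pow_smul one_pos m
  rw [circleIntegral] at h
  have hI : ∀ θ : ℝ, deriv (circleMap 0 1) θ • (1 / (circleMap 0 1 θ - 0) ^ (m + 1)) •
      f (circleMap 0 1 θ) =
      Complex.I * (f (Circle.exp θ) * (starRingEnd ℂ) (Circle.exp θ : ℂ) ^ m) := by
    intro θ
    have e : circleMap 0 1 θ = (Circle.exp θ : ℂ) := by simp [circleMap]
    rw [deriv_circleMap, e, ← Circle.coe_inv_eq_conj, Circle.coe_inv]
    have := Circle.coe_ne_zero (Circle.exp θ)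
    simp only [smul_eq_mul, sub_zero, inv_pow, pow_succ]
    field_simp
  simp only [hI] at h
  rw [intervalIntegral.integral_const_mul] at h
  apply mul_left_cancel₀ Complex.I_ne_zero
  rw [h, smul_eq_mul]
  ring

/-- Unlike `iteratedDeriv_comp_const_mul`, this needs no smoothness of `k`. -/
theorem iteratedDeriv_comp_const_mul_field (k : ℂ → ℂ) (ζ : ℂ) (m : ℕ) :
    iteratedDeriv m (fun t => k (ζ * t)) = fun t => ζ ^ m * iteratedDeriv m k (ζ * t) := by
  induction m with
  | zero => simp
  | succ m ih =>
    rw [iteratedDeriv_succ, ih]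
    ext t
    rw [deriv_const_mul_field, deriv_comp_mul_left ζ (iteratedDeriv m k) t, iteratedDeriv_succ,
      smul_eq_mul]
    ring

/-- Integrating a holomorphic function `G` against `conj (z j) ^ m` times a function of `‖z j‖`
only sees one Taylor coefficient `a` of `G`, which does not depend on the radial factor. -/
theorem IsTorusInvariant.exists_coeff {n : ℕ} {Ω : Set (Fin n → ℂ)} {w : (Fin n → ℂ) → ℝ}
    (h : IsTorusInvariant Ω w) (hΩ : IsCompleteReinhardtDomain Ω) {G : (Fin n → ℂ) → ℂ}
    (hG : DifferentiableOn ℂ G Ω) (j : Fin n) (m : ℕ) :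
    ∃ a : ℂ, ∀ φ : ℝ → ℂ,
      Integrable (fun z => G z * ((starRingEnd ℂ) (z j) ^ m * φ ‖z j‖)) (weightedMeasure Ω w) →
      ∫ z, G z * ((starRingEnd ℂ) (z j) ^ m * φ ‖z j‖) ∂weightedMeasure Ω w =
        a * ∫ z, (‖z j‖ : ℂ) ^ (2 * m) * φ ‖z j‖ ∂weightedMeasure Ω w := by
  have hm := hΩ.isOpen.measurableSet
  have hae := ae_mem_weightedMeasure w hm
  have hpi : (2 * Real.pi : ℂ) ≠ 0 := by simp [Real.pi_ne_zero]
  set k : ℂ → ℂ := fun ζ => G (Pi.single j ζ) with hk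
  refine ⟨iteratedDeriv m k 0 / m.factorial, fun φ hφ => ?_⟩
  -- averaging over the rotations of all coordinates except the `j`-th replaces `G z` by `k (z j)`
  set c₁ : ℝ → Fin n → Circle := fun θ i => if i = j then 1 else Circle.exp θ with hc₁
  have hc₁c : ∀ i, Continuous fun θ => c₁ θ i := by
    intro i
    by_cases hi : i = j
    · simp only [hc₁, hi, if_true]; fun_prop
    · simp only [hc₁, hi, if_false]; fun_prop
  obtain ⟨hi₁, he₁⟩ := h.integral_average hm hc₁c hφ
  have hav₁ : ∀ z ∈ Ω, (∫ θ in (0 : ℝ)..2 * Real.pi, G (fun i => (c₁ θ i : ℂ) * z i) *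
      ((starRingEnd ℂ) ((c₁ θ j : ℂ) * z j) ^ m * φ ‖(c₁ θ j : ℂ) * z j‖)) =
      2 * Real.pi * (k (z j) * ((starRingEnd ℂ) (z j) ^ m * φ ‖z j‖)) := by
    intro z hz
    set f : ℂ → ℂ := fun t => G fun i => (if i = j then 1 else t) * z i with hf
    have hfd : DifferentiableOn ℂ f (Metric.closedBall 0 1) := by
      refine hG.comp (t := Ω) (f := fun t : ℂ => fun i => (if i = j then 1 else t) * z i) ?_ ?_
      · refine differentiableOn_pi.2 fun i => ?_
        by_cases hi : i = j
        · simp only [hi, if_true]; fun_prop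
        · simp only [hi, if_false]; fun_prop
      · intro t ht
        refine hΩ.mem_of_norm_le z hz _ fun i => ?_
        have ht' : ‖t‖ ≤ 1 := by simpa using ht
        by_cases hi : i = j
        · simp [hi]
        · simp only [hi, if_false, norm_mul]
          exact mul_le_of_le_one_left (norm_nonneg _) ht'
    have hint := integral_conj_circleMap_pow_mul hfd 0
    have e0 : f 0 = k (z j) := by
      simp only [hf, hk]
      congr 1
      ext i
      by_cases hi : i = j
      · subst hi; simp
      · simp [hi]
    simp only [pow_zero, mul_one, iteratedDeriv_zero, Nat.factorial_zero, Nat.cast_one, div_one,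
      e0] at hint
    rw [← mul_assoc, ← hint, ← intervalIntegral.integral_mul_const]
    refine intervalIntegral.integral_congr fun θ _ => ?_
    simp only [hc₁, hf, if_true, Circle.coe_one, one_mul]
    congr 3
    ext i
    by_cases hi : i = j <;> simp [hi]
  have hi₂ : Integrable (fun z => k (z j) * ((starRingEnd ℂ) (z j) ^ m * φ ‖z j‖))
      (weightedMeasure Ω w) := by
    have : Integrable (fun z => 2 * Real.pi * (k (z j) * ((starRingEnd ℂ) (z j) ^ m * φ ‖z j‖)))
        (weightedMeasure Ω w) := hi₁.congr (hae.mono fun z hz => hav₁ z hz)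
    exact (integrable_const_mul_iff (IsUnit.mk0 _ hpi) _).1 this
  have he₁' : ∫ z, G z * ((starRingEnd ℂ) (z j) ^ m * φ ‖z j‖) ∂weightedMeasure Ω w =
      ∫ z, k (z j) * ((starRingEnd ℂ) (z j) ^ m * φ ‖z j‖) ∂weightedMeasure Ω w := by
    apply mul_left_cancel₀ hpi
    rw [← he₁, integral_congr_ae (hae.mono fun z hz => hav₁ z hz), integral_const_mul]
  -- averaging over the rotations of the `j`-th coordinate extracts the `m`-th coefficient of `k`
  obtain ⟨-, he₂⟩ := h.integral_average hm (c := fun θ _ => Circle.exp θ)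
    (fun _ => by fun_prop) hi₂
  rw [he₁']
  apply mul_left_cancel₀ hpi
  rw [← he₂, ← integral_const_mul, ← integral_const_mul]
  refine integral_congr_ae (hae.mono fun z hz => ?_)
  have hfd : DifferentiableOn ℂ (fun t => k (z j * t)) (Metric.closedBall 0 1) := by
    refine hG.comp (t := Ω) (f := fun t : ℂ => Pi.single j (z j * t)) ?_ ?_
    · refine differentiableOn_pi.2 fun i => ?_
      by_cases hi : i = j
      · subst hi; simp only [Pi.single_eq_same]; fun_prop
      · simp only [Pi.single_eq_of_ne hi]; fun_prop
    · intro t ht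
      refine hΩ.mem_of_norm_le z hz _ fun i => ?_
      have ht' : ‖t‖ ≤ 1 := by simpa using ht
      by_cases hi : i = j
      · subst hi
        simp only [Pi.single_eq_same, norm_mul]
        exact mul_le_of_le_one_right (norm_nonneg _) ht'
      · simp [Pi.single_eq_of_ne hi]
  have hint := integral_conj_circleMap_pow_mul hfd m
  simp only [iteratedDeriv_comp_const_mul_field, mul_zero] at hint
  have e : ∀ θ : ℝ, k ((Circle.exp θ : ℂ) * z j) * ((starRingEnd ℂ) ((Circle.exp θ : ℂ) * z j) ^ m *
      φ ‖(Circle.exp θ : ℂ) * z j‖) = k (z j * Circle.exp θ) *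
      (starRingEnd ℂ) (Circle.exp θ : ℂ) ^ m * ((starRingEnd ℂ) (z j) ^ m * φ ‖z j‖) := by
    intro θ
    rw [norm_mul, Circle.norm_coe, one_mul, map_mul, mul_pow, mul_comm (z j)]
    ring
  simp only [e]
  rw [intervalIntegral.integral_mul_const, hint, pow_mul, ← Complex.mul_conj', mul_pow]
  ring

/-! ### Moment inequality from boundedness on `L^p` -/

/-- The moment of order `s` of the modulus of the `j`-th coordinate. -/
noncomputable def coordMoment {n : ℕ} (Ω : Set (Fin n → ℂ)) (w : (Fin n → ℂ) → ℝ) (j : Fin n)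
    (s : ℝ) : ℝ :=
  ∫ z, ‖z j‖ ^ s ∂weightedMeasure Ω w

theorem coordMoment_nonneg {n : ℕ} (Ω : Set (Fin n → ℂ)) (w : (Fin n → ℂ) → ℝ) (j : Fin n)
    (s : ℝ) : 0 ≤ coordMoment Ω w j s :=
  integral_nonneg fun z => by positivity

theorem memLp_of_norm_le_rpow {n : ℕ} {Ω : Set (Fin n → ℂ)} {w : (Fin n → ℂ) → ℝ}
    [IsFiniteMeasure (weightedMeasure Ω w)] (hΩ : MeasurableSet Ω) (hb : Bornology.IsBounded Ω)
    {E : Type*} [NormedAddCommGroup E] {f : (Fin n → ℂ) → E} {j : Fin n} {s : ℝ} (hs : 0 ≤ s)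
    (hf : AEStronglyMeasurable f (weightedMeasure Ω w)) (hfs : ∀ z, ‖f z‖ ≤ ‖z j‖ ^ s) (p : ℝ≥0∞) :
    MemLp f p (weightedMeasure Ω w) := by
  obtain ⟨M, hM⟩ := hb.exists_norm_le
  refine MemLp.of_bound hf (M ^ s) ((ae_mem_weightedMeasure w hΩ).mono fun z hz => ?_)
  exact (hfs z).trans (Real.rpow_le_rpow (norm_nonneg _) ((norm_le_pi_norm z j).trans (hM z hz)) hs)

theorem integrable_coord_rpow {n : ℕ} {Ω : Set (Fin n → ℂ)} {w : (Fin n → ℂ) → ℝ}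
    [IsFiniteMeasure (weightedMeasure Ω w)] (hΩ : MeasurableSet Ω) (hb : Bornology.IsBounded Ω)
    (j : Fin n) {s : ℝ} (hs : 0 ≤ s) :
    Integrable (fun z => ‖z j‖ ^ s) (weightedMeasure Ω w) := by
  refine memLp_one_iff_integrable.1 (memLp_of_norm_le_rpow (j := j) hΩ hb hs
    (by fun_prop : Measurable fun z : Fin n → ℂ => ‖z j‖ ^ s).aestronglyMeasurable (fun z => ?_) 1)
  rw [Real.norm_of_nonneg (by positivity)]

theorem pow_mul_rpow_natCast_mul {x : ℝ} (hx : 0 ≤ x) (k m : ℕ) {r : ℝ}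
    (h : (k : ℝ) + m * r ≠ 0) : x ^ k * x ^ (m * r) = x ^ ((k : ℝ) + m * r) := by
  rw [Real.rpow_add' hx h, Real.rpow_natCast]

/-- Orthogonality: pairings with a holomorphic function do not see the complement of the Bergman
space. -/
theorem integral_bergmanProjection_mul_conj {n : ℕ} {Ω : Set (Fin n → ℂ)} {w : (Fin n → ℂ) → ℝ}
    (h : IsWeight Ω w) (f : Lp ℂ 2 (weightedMeasure Ω w)) {g : (Fin n → ℂ) → ℂ}
    (hg : DifferentiableOn ℂ g Ω) (hg2 : MemLp g 2 (weightedMeasure Ω w)) :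
    ∫ z, bergmanProjection h f z * (starRingEnd ℂ) (g z) ∂weightedMeasure Ω w =
      ∫ z, f z * (starRingEnd ℂ) (g z) ∂weightedMeasure Ω w := by
  have : CompleteSpace (bergmanSpace Ω w) := (isClosed_bergmanSpace h).completeSpace_coe
  have hmem : hg2.toLp g ∈ bergmanSpace Ω w := ⟨g, hg, hg2.coeFn_toLp⟩
  have key : ∀ u : Lp ℂ 2 (weightedMeasure Ω w), inner ℂ (hg2.toLp g) u =
      ∫ z, u z * (starRingEnd ℂ) (g z) ∂weightedMeasure Ω w := fun u => by
    rw [L2.inner_def]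
    refine integral_congr_ae (hg2.coeFn_toLp.mono fun z hz => ?_)
    simp only [hz, RCLike.inner_apply]
  rw [← key, ← key]
  have := (bergmanSpace Ω w).sub_starProjection_mem_orthogonal f
  have h0 := Submodule.inner_right_of_mem_orthogonal hmem this
  rw [inner_sub_right, sub_eq_zero] at h0
  exact h0.symm

theorem exists_differentiableOn_bergmanProjection {n : ℕ} {Ω : Set (Fin n → ℂ)}
    {w : (Fin n → ℂ) → ℝ} (h : IsWeight Ω w) (f : Lp ℂ 2 (weightedMeasure Ω w)) :
    ∃ G : (Fin n → ℂ) → ℂ, DifferentiableOn ℂ G Ω ∧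
      bergmanProjection h f =ᵐ[weightedMeasure Ω w] G := by
  have : CompleteSpace (bergmanSpace Ω w) := (isClosed_bergmanSpace h).completeSpace_coe
  exact (bergmanSpace Ω w).starProjection_apply_mem f

/-- Boundedness on `L^p` forces a reverse Hölder inequality for the moments of a coordinate. It
comes from the extremal function `z j ^ m * ‖z j‖ ^ (m * (q - 2))` for the pairing of `L^p` with
the monomial `z j ^ m`. -/
theorem coordMoment_mul_le_of_isBoundedOnLp {n : ℕ} {Ω : Set (Fin n → ℂ)} {w : (Fin n → ℂ) → ℝ}
    [IsFiniteMeasure (weightedMeasure Ω w)] (hΩ : IsCompleteReinhardtDomain Ω)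
    (hb : Bornology.IsBounded Ω) (ht : IsTorusInvariant Ω w) (h : IsWeight Ω w) {p q : ℝ}
    (hpq : p.HolderConjugate q) (hB : IsBoundedOnLp (bergmanProjection h) (ENNReal.ofReal p))
    (j : Fin n) :
    ∃ C : ℝ, ∀ m : ℕ, m ≠ 0 → 0 < coordMoment Ω w j (m * p) → 0 < coordMoment Ω w j (m * q) →
      coordMoment Ω w j (m * p) ^ (1 / p) * coordMoment Ω w j (m * q) ^ (1 / q) ≤
        C * coordMoment Ω w j (m * 2) := by
  obtain ⟨C, hC⟩ := hB
  refine ⟨C, fun m hm hAp hAq => ?_⟩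
  have hmeas := hΩ.isOpen.measurableSet
  have hm0 : (0 : ℝ) < m := by positivity
  have hp0 := hpq.pos
  have hq0 := hpq.symm.pos
  have hp1 : 0 < p - 1 := sub_pos.2 hpq.lt
  have hq1 : 0 < q - 1 := sub_pos.2 hpq.symm.lt
  set μ := weightedMeasure Ω w
  set f₀ : (Fin n → ℂ) → ℂ := fun z => z j ^ m * ((‖z j‖ ^ (m * (q - 2)) : ℝ) : ℂ) with hf₀
  have hf₀n : ∀ z, ‖f₀ z‖ = ‖z j‖ ^ (m * (q - 1)) := fun z => by
    have e : (m : ℝ) + m * (q - 2) = m * (q - 1) := by ring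
    rw [hf₀, norm_mul, norm_pow, Complex.norm_real, Real.norm_of_nonneg (by positivity),
      pow_mul_rpow_natCast_mul (norm_nonneg _) _ _ (by rw [e]; positivity), e]
  have hf₀m : AEStronglyMeasurable f₀ μ := by
    have : Measurable f₀ := by simp only [hf₀]; fun_prop
    exact this.aestronglyMeasurable
  have hf₀L : ∀ r, MemLp f₀ r μ :=
    memLp_of_norm_le_rpow hmeas hb (by positivity) hf₀m fun z => (hf₀n z).le
  set f : Lp ℂ 2 μ := (hf₀L 2).toLp f₀ with hf
  have hff₀ : f =ᵐ[μ] f₀ := (hf₀L 2).coeFn_toLp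
  obtain ⟨G, hG, hfG⟩ := exists_differentiableOn_bergmanProjection h f
  obtain ⟨a, ha⟩ := ht.exists_coeff hΩ hG j m
  have hGL2 : MemLp G 2 μ := (memLp_congr_ae hfG).1 (Lp.memLp _)
  have hCf := hC f ((memLp_congr_ae hff₀).2 (hf₀L _))
  rw [eLpNorm_congr_ae hfG, eLpNorm_congr_ae hff₀] at hCf
  have hGLp : MemLp G (ENNReal.ofReal p) μ :=
    ⟨hGL2.1, hCf.trans_lt (ENNReal.mul_lt_top ENNReal.coe_lt_top (hf₀L _).2)⟩
  have hmon : Measurable fun z : Fin n → ℂ => z j ^ m := by fun_prop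
  have hgL2 : MemLp (fun z : Fin n → ℂ => z j ^ m) 2 μ :=
    memLp_of_norm_le_rpow (s := m) (j := j) hmeas hb hm0.le hmon.aestronglyMeasurable
      (fun z => by rw [norm_pow, Real.rpow_natCast]) 2
  -- the pairing with the monomial, before and after projecting
  have h1 : ((coordMoment Ω w j (m * q) : ℝ) : ℂ) = a * (coordMoment Ω w j (m * 2) : ℝ) := by
    have e := integral_bergmanProjection_mul_conj h f (g := fun z => z j ^ m) (by fun_prop) hgL2
    have e1 : ∫ z, f z * (starRingEnd ℂ) (z j ^ m) ∂μ = (coordMoment Ω w j (m * q) : ℝ) := by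
      rw [coordMoment, ← integral_complex_ofReal]
      refine integral_congr_ae (hff₀.mono fun z hz => ?_)
      have e2 : ((2 * m : ℕ) : ℝ) + m * (q - 2) = m * q := by push_cast; ring
      simp only [hz, hf₀, ← e2]
      rw [← pow_mul_rpow_natCast_mul (norm_nonneg _) _ _ (by rw [e2]; positivity), pow_mul, map_pow,
        Complex.ofReal_mul, Complex.ofReal_pow, Complex.ofReal_pow, ← Complex.mul_conj', mul_pow]
      ring
    have e2 : ∫ z, bergmanProjection h f z * (starRingEnd ℂ) (z j ^ m) ∂μ =
        ∫ z, G z * ((starRingEnd ℂ) (z j) ^ m * (fun _ => 1) ‖z j‖) ∂μ :=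
      integral_congr_ae (hfG.mono fun z hz => by simp only [hz, map_pow, mul_one])
    rw [← e1, ← e, e2, ha (fun _ => 1), coordMoment, ← integral_complex_ofReal]
    · simp only [mul_one]
      congr 2
      ext z
      rw [show (m : ℝ) * 2 = ((2 * m : ℕ) : ℝ) by push_cast; ring, Real.rpow_natCast]
      push_cast; rfl
    · have := hGL2.integrable_mul hgL2.star
      refine this.congr (ae_of_all _ fun z => ?_)
      simp
  -- the pairing of the projection with the function dual to the monomial in `L^p`
  set g₀ : (Fin n → ℂ) → ℂ := fun z => (starRingEnd ℂ) (z j) ^ m *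
    ((‖z j‖ ^ (m * (p - 2)) : ℝ) : ℂ) with hg₀
  have hg₀n : ∀ z, ‖g₀ z‖ = ‖z j‖ ^ (m * (p - 1)) := fun z => by
    have e : (m : ℝ) + m * (p - 2) = m * (p - 1) := by ring
    rw [hg₀, norm_mul, norm_pow, Complex.norm_real, Real.norm_of_nonneg (by positivity),
      RCLike.norm_conj, pow_mul_rpow_natCast_mul (norm_nonneg _) _ _ (by rw [e]; positivity), e]
  have hg₀m : AEStronglyMeasurable g₀ μ := by
    have : Measurable g₀ := by
      have hc : Measurable fun z : Fin n → ℂ => (starRingEnd ℂ) (z j) :=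
        (Complex.continuous_conj.comp (continuous_apply j)).measurable
      simp only [hg₀]; fun_prop
    exact this.aestronglyMeasurable
  have hg₀L : ∀ r, MemLp g₀ r μ :=
    memLp_of_norm_le_rpow hmeas hb (by positivity) hg₀m fun z => (hg₀n z).le
  have h2 : ∫ z, G z * g₀ z ∂μ = a * (coordMoment Ω w j (m * p) : ℝ) := by
    rw [hg₀, ha (fun x => ((x ^ (m * (p - 2)) : ℝ) : ℂ)) (hGL2.integrable_mul (hg₀L 2)),
      coordMoment, ← integral_complex_ofReal]
    congr 2
    ext z
    have e2 : ((2 * m : ℕ) : ℝ) + m * (p - 2) = m * p := by push_cast; ring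
    rw [← e2, ← pow_mul_rpow_natCast_mul (norm_nonneg _) _ _ (by rw [e2]; positivity)]
    push_cast
    rfl
  have hnorm : ∀ {u : (Fin n → ℂ) → ℂ} {s r : ℝ}, (∀ z, ‖u z‖ = ‖z j‖ ^ (m * s)) →
      ∫ z, ‖u z‖ ^ r ∂μ = coordMoment Ω w j (m * (s * r)) := fun {u s r} hu => by
    rw [coordMoment]
    congr 1
    ext z
    rw [hu, ← Real.rpow_mul (norm_nonneg _), mul_assoc]
  have hp' : (p - 1) * q = p := by have := hpq.mul_eq_add; linarith
  have hq' : (q - 1) * p = q := by have := hpq.mul_eq_add; linarith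
  have h3 : ‖a‖ * coordMoment Ω w j (m * p) ≤
      (∫ z, ‖G z‖ ^ p ∂μ) ^ (1 / p) * coordMoment Ω w j (m * p) ^ (1 / q) := by
    calc ‖a‖ * coordMoment Ω w j (m * p) = ‖∫ z, G z * g₀ z ∂μ‖ := by
          rw [h2, norm_mul, Complex.norm_real, Real.norm_of_nonneg hAp.le]
      _ ≤ ∫ z, ‖G z‖ * ‖g₀ z‖ ∂μ := by
          simpa only [norm_mul] using norm_integral_le_integral_norm (μ := μ) fun z => G z * g₀ z
      _ ≤ _ := by
          have := integral_mul_norm_le_Lp_mul_Lq hpq hGLp (hg₀L _)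
          rwa [hnorm hg₀n, hp'] at this
  have h4 : (∫ z, ‖G z‖ ^ p ∂μ) ^ (1 / p) ≤ C * coordMoment Ω w j (m * q) ^ (1 / p) := by
    have hpE : ENNReal.ofReal p ≠ 0 := by simpa using hp0
    rw [hGLp.eLpNorm_eq_integral_rpow_norm hpE ENNReal.ofReal_ne_top,
      (hf₀L _).eLpNorm_eq_integral_rpow_norm hpE ENNReal.ofReal_ne_top,
      ENNReal.toReal_ofReal hp0.le, hnorm hf₀n, hq', ← ENNReal.ofReal_coe_nnreal,
      ← ENNReal.ofReal_mul C.coe_nonneg, ENNReal.ofReal_le_ofReal_iff (by positivity)] at hCf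
    simpa only [one_div] using hCf
  have h5 : coordMoment Ω w j (m * q) = ‖a‖ * coordMoment Ω w j (m * 2) := by
    have := congrArg norm h1
    rwa [norm_mul, Complex.norm_real, Complex.norm_real, Real.norm_of_nonneg hAq.le,
      Real.norm_of_nonneg (coordMoment_nonneg _ _ _ _)] at this
  have hsum : 1 / p + 1 / q = 1 := by simpa using hpq.inv_add_inv_eq_one
  have hsplit : ∀ x : ℝ, 0 < x → x = x ^ (1 / p) * x ^ (1 / q) := fun x hx => by
    rw [← Real.rpow_add hx, hsum, Real.rpow_one]
  set Ap := coordMoment Ω w j (m * p)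
  set Aq := coordMoment Ω w j (m * q)
  set A2 := coordMoment Ω w j (m * 2)
  have hA2 : 0 ≤ A2 := coordMoment_nonneg _ _ _ _
  have hpos : 0 < Ap ^ (1 / q) * Aq ^ (1 / p) := by positivity
  refine le_of_mul_le_mul_right ?_ hpos
  calc Ap ^ (1 / p) * Aq ^ (1 / q) * (Ap ^ (1 / q) * Aq ^ (1 / p))
      = (Ap ^ (1 / p) * Ap ^ (1 / q)) * (Aq ^ (1 / p) * Aq ^ (1 / q)) := by ring
    _ = Ap * (‖a‖ * A2) := by rw [← hsplit _ hAp, ← hsplit _ hAq, h5]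
    _ = (‖a‖ * Ap) * A2 := by ring
    _ ≤ (C * Aq ^ (1 / p) * Ap ^ (1 / q)) * A2 := by
        refine mul_le_mul_of_nonneg_right (h3.trans ?_) hA2
        exact mul_le_mul_of_nonneg_right h4 (by positivity)
    _ = _ := by ring

/-! ### Boundary behaviour of multi-radial defining functions -/

/-- The largest modulus `R` of the `j`-th coordinate on a bounded complete Reinhardt domain. -/
theorem IsCompleteReinhardtDomain.exists_radius {n : ℕ} {Ω : Set (Fin n → ℂ)}
    (hΩ : IsCompleteReinhardtDomain Ω) (hb : Bornology.IsBounded Ω) (j : Fin n) :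
    ∃ R : ℝ, 0 < R ∧ (∀ z ∈ Ω, ‖z j‖ < R) ∧
      ∀ r : ℝ, 0 ≤ r → r < R → (Pi.single j (r : ℂ) : Fin n → ℂ) ∈ Ω := by
  obtain ⟨z₀, hz₀⟩ := hΩ.isConnected.nonempty
  obtain ⟨M, hM⟩ := hb.exists_norm_le
  have hbdd : BddAbove ((fun z : Fin n → ℂ => ‖z j‖) '' Ω) :=
    ⟨M, by rintro _ ⟨z, hz, rfl⟩; exact (norm_le_pi_norm z j).trans (hM z hz)⟩
  have hlt : ∀ z ∈ Ω, ‖z j‖ < sSup ((fun z : Fin n → ℂ => ‖z j‖) '' Ω) := by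
    intro z hz
    -- openness of `Ω` leaves room to enlarge the `j`-th coordinate
    have hcont : Continuous fun t : ℝ => Function.update z j ((‖z j‖ + t : ℝ) : ℂ) := by fun_prop
    have h0 : Function.update z j ((‖z j‖ + 0 : ℝ) : ℂ) ∈ Ω := by
      refine hΩ.mem_of_norm_le z hz _ fun i => ?_
      by_cases hi : i = j
      · subst hi; simp
      · simp [Function.update_of_ne hi]
    have hev := (hcont.tendsto 0).eventually (hΩ.isOpen.mem_nhds h0)
    obtain ⟨t, ht, ht0⟩ := ((hev.filter_mono nhdsWithin_le_nhds).and
      (self_mem_nhdsWithin : Set.Ioi (0 : ℝ) ∈ 𝓝[>] 0)).exists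
    have ht0 : 0 < t := ht0
    have h1 := le_csSup hbdd (Set.mem_image_of_mem _ ht)
    simp only [Function.update_self, Complex.norm_real] at h1
    rw [Real.norm_of_nonneg (by positivity)] at h1
    linarith
  refine ⟨_, (norm_nonneg _).trans_lt (hlt z₀ hz₀), hlt, fun r hr hrR => ?_⟩
  obtain ⟨_, ⟨z, hz, rfl⟩, hrz⟩ := exists_lt_of_lt_csSup (Set.Nonempty.image _ ⟨z₀, hz₀⟩) hrR
  refine hΩ.mem_of_norm_le z hz _ fun i => ?_
  by_cases hi : i = j
  · subst hi; simpa [abs_of_nonneg hr] using hrz.le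
  · simp [Pi.single_eq_of_ne hi]

theorem IsMultiRadialDefiningFunction.neg {n : ℕ} {Ω : Set (Fin n → ℂ)} {ρ : (Fin n → ℂ) → ℝ}
    (hρ : IsMultiRadialDefiningFunction Ω ρ) {z : Fin n → ℂ} (hz : z ∈ Ω) : ρ z < 0 := by
  obtain ⟨U, -, -, -, hΩU, -⟩ := hρ.exists_nhd
  rw [hΩU] at hz
  exact hz.2

theorem IsMultiRadialDefiningFunction.isTorusInvariant {n : ℕ} {Ω : Set (Fin n → ℂ)}
    {ρ : (Fin n → ℂ) → ℝ} (hΩ : IsCompleteReinhardtDomain Ω)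
    (hρ : IsMultiRadialDefiningFunction Ω ρ) :
    IsTorusInvariant Ω fun z => Real.exp (1 / ρ z) := by
  have hmem : ∀ z ∈ Ω, ∀ u : Fin n → Circle, (fun i => (u i : ℂ) * z i) ∈ Ω := fun z hz u =>
    hΩ.mem_of_norm_le z hz _ fun i => by rw [norm_mul, Circle.norm_coe, one_mul]
  obtain ⟨U, -, hcl, -, -, hrad⟩ := hρ.exists_nhd
  refine ⟨hmem, fun z hz u => ?_⟩
  exact congrArg (fun x => Real.exp (1 / x)) (hrad _ (hcl (subset_closure (hmem z hz u))) _
    (hcl (subset_closure hz)) fun i => by rw [norm_mul, Circle.norm_coe, one_mul])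

theorem IsMultiRadialDefiningFunction.isFiniteMeasure {n : ℕ} {Ω : Set (Fin n → ℂ)}
    {ρ : (Fin n → ℂ) → ℝ} (hΩ : IsOpen Ω) (hb : Bornology.IsBounded Ω)
    (hρ : IsMultiRadialDefiningFunction Ω ρ) :
    IsFiniteMeasure (weightedMeasure Ω fun z => Real.exp (1 / ρ z)) := by
  refine ⟨?_⟩
  rw [weightedMeasure, withDensity_apply _ MeasurableSet.univ, Measure.restrict_univ]
  calc ∫⁻ z in Ω, ENNReal.ofReal (Real.exp (1 / ρ z)) ≤ ∫⁻ z in Ω, 1 := by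
        refine setLIntegral_mono' hΩ.measurableSet fun z hz => ?_
        rw [ENNReal.ofReal_le_one, Real.exp_le_one_iff]
        exact one_div_nonpos.2 (hρ.neg hz).le
    _ < ⊤ := by
        rw [setLIntegral_one]
        exact hb.measure_lt_top

/-- `-ρ` is at most a multiple of `R - ‖z j‖`: enlarging the `j`-th coordinate leads to a boundary
point at distance at most `R - ‖z j‖`, and `ρ` is Lipschitz on the compact closure of `Ω`. -/
theorem IsMultiRadialDefiningFunction.exists_neg_le_mul_sub {n : ℕ} {Ω : Set (Fin n → ℂ)}
    {ρ : (Fin n → ℂ) → ℝ} (hΩ : IsCompleteReinhardtDomain Ω) (hb : Bornology.IsBounded Ω)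
    (hρ : IsMultiRadialDefiningFunction Ω ρ) {j : Fin n} {R : ℝ} (hR : ∀ z ∈ Ω, ‖z j‖ < R) :
    ∃ M : ℝ, 0 < M ∧ ∀ z ∈ Ω, -ρ z ≤ M * (R - ‖z j‖) := by
  obtain ⟨U, hU, hcl, hsm, hΩU, hrad⟩ := hρ.exists_nhd
  have hlip : LocallyLipschitzOn (closure Ω) ρ := fun x hx => by
    have hat : ContDiffAt ℝ 1 ρ x :=
      (hsm.contDiffAt (hU.mem_nhds (hcl hx))).of_le (by exact_mod_cast le_top)
    obtain ⟨K, t, ht, hK⟩ := hat.exists_lipschitzOnWith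
    exact ⟨K, t, mem_nhdsWithin_of_mem_nhds ht, hK⟩
  obtain ⟨K, hK⟩ := hlip.exists_lipschitzOnWith_of_compact hb.isCompact_closure
  refine ⟨K + 1, by positivity, fun z hz => ?_⟩
  -- a real segment in the direction of the `j`-th coordinate that leaves `Ω` before reaching `R`
  set x : ℝ → Fin n → ℂ := fun t => Function.update z j (t : ℂ) with hx
  have hxc : Continuous x := by fun_prop
  have hxz : ∀ i, ‖x ‖z j‖ i‖ = ‖z i‖ := fun i => by
    by_cases hi : i = j
    · subst hi; simp [hx]
    · simp [hx, Function.update_of_ne hi]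
  have hx0 : x ‖z j‖ ∈ Ω := hΩ.mem_of_norm_le z hz _ fun i => (hxz i).le
  have hx1 : x R ∉ Ω := fun h => by
    have := hR _ h
    simp only [hx, Function.update_self, Complex.norm_real] at this
    exact this.not_ge (le_abs_self R)
  have hzR : ‖z j‖ ≤ R := (hR z hz).le
  obtain ⟨t, ht, htcl, htΩ⟩ : ∃ t ∈ Set.Icc ‖z j‖ R, x t ∈ closure Ω ∧ x t ∉ Ω := by
    by_contra! hno
    have hpre : IsPreconnected (x '' Set.Icc ‖z j‖ R) :=
      isPreconnected_Icc.image _ hxc.continuousOn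
    have := isPreconnected_iff_subset_of_disjoint.1 hpre Ω (closure Ω)ᶜ hΩ.isOpen
      isClosed_closure.isOpen_compl (by
        rintro _ ⟨t, ht, rfl⟩
        by_cases h : x t ∈ closure Ω
        · exact Or.inl (hno t ht h)
        · exact Or.inr h) (by
        rw [Set.eq_empty_iff_forall_notMem]
        rintro y ⟨-, hy, hy'⟩
        exact hy' (subset_closure hy))
    rcases this with h | h
    · exact hx1 (h ⟨R, ⟨hzR, le_rfl⟩, rfl⟩)
    · exact h ⟨‖z j‖, ⟨le_rfl, hzR⟩, rfl⟩ (subset_closure hx0)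
  have hρt : 0 ≤ ρ (x t) := by
    by_contra! h
    exact htΩ (by rw [hΩU]; exact ⟨hcl htcl, h⟩)
  have hρz : ρ z = ρ (x ‖z j‖) :=
    hrad _ (hcl (subset_closure hz)) _ (hcl (subset_closure hx0)) fun i => (hxz i).symm
  have hdist : dist (x t) (x ‖z j‖) ≤ R - ‖z j‖ := by
    refine (dist_pi_le_iff (by linarith)).2 fun i => ?_
    by_cases hi : i = j
    · subst hi
      simp only [hx, Function.update_self, Complex.dist_of_im_eq, Complex.ofReal_im,
        Complex.ofReal_re]
      rw [Real.dist_eq, abs_of_nonneg (by linarith [ht.1])]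
      linarith [ht.2]
    · simp only [hx, Function.update_of_ne hi, dist_self]
      linarith
  have h1 := hK.dist_le_mul _ htcl _ (subset_closure hx0)
  rw [Real.dist_eq] at h1
  have h2 := le_abs_self (ρ (x t) - ρ (x ‖z j‖))
  have h3 : (K : ℝ) * dist (x t) (x ‖z j‖) ≤ K * (R - ‖z j‖) := by gcongr
  rw [hρz]
  linarith

/-- Let `P` be the boundary point on the positive `j`-th axis. By symmetry `dρ` only sees the radial
direction at `P`, so balls of radius `δ / 2` centred at distance `δ` from `P` on that axis lie in `Ω`
and `-ρ` is at least a multiple of `δ` on them. -/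
theorem IsMultiRadialDefiningFunction.exists_closedBall_subset {n : ℕ} {Ω : Set (Fin n → ℂ)}
    {ρ : (Fin n → ℂ) → ℝ} (hρ : IsMultiRadialDefiningFunction Ω ρ) {j : Fin n} {R : ℝ} (hR0 : 0 < R)
    (hR : ∀ z ∈ Ω, ‖z j‖ < R)
    (hsingle : ∀ r : ℝ, 0 ≤ r → r < R → (Pi.single j (r : ℂ) : Fin n → ℂ) ∈ Ω) :
    ∃ κ : ℝ, 0 < κ ∧ ∀ᶠ δ in 𝓝[>] (0 : ℝ), ∀ z ∈ Metric.closedBall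
      (Pi.single j ((R - δ : ℝ) : ℂ)) (δ / 2), z ∈ Ω ∧ κ * δ ≤ -ρ z ∧ R - 2 * δ ≤ ‖z j‖ := by
  obtain ⟨U, hU, hcl, hsm, hΩU, hrad⟩ := hρ.exists_nhd
  set P : Fin n → ℂ := Pi.single j (R : ℂ) with hP
  set e : Fin n → ℂ := Pi.single j 1 with he
  have hPt : ∀ t : ℝ, P + (-t) • e = Pi.single j ((R - t : ℝ) : ℂ) := fun t => by
    ext i
    by_cases hi : i = j
    · subst hi; simp [hP, he, sub_eq_add_neg]
    · simp [hP, he, Pi.single_eq_of_ne hi]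
  have hPΩ : P ∉ Ω := fun h => by
    have := hR _ h
    simp only [hP, Pi.single_eq_same, Complex.norm_real] at this
    exact this.not_ge (le_abs_self R)
  have hin : ∀ᶠ t : ℝ in 𝓝[>] 0, P + (-t) • e ∈ Ω := by
    filter_upwards [Ioo_mem_nhdsGT hR0] with t ht
    rw [hPt]
    exact hsingle _ (by linarith [ht.2]) (by linarith [ht.1])
  have hpath : Tendsto (fun t : ℝ => P + (-t) • e) (𝓝[>] 0) (𝓝 P) := by
    have : Continuous fun t : ℝ => P + (-t) • e := by fun_prop
    have h := (this.tendsto 0).mono_left (nhdsWithin_le_nhds (s := Set.Ioi 0))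
    simpa using h
  have hPcl : P ∈ closure Ω := mem_closure_of_tendsto hpath hin
  have hPfr : P ∈ frontier Ω := ⟨hPcl, fun h => hPΩ (interior_subset h)⟩
  have hdiff : DifferentiableAt ℝ ρ P :=
    (hsm.contDiffAt (hU.mem_nhds (hcl hPcl))).differentiableAt (by simp)
  have hρP : ρ P = 0 := by
    apply le_antisymm
    · exact le_of_tendsto (hdiff.continuousAt.tendsto.comp hpath)
        (hin.mono fun t ht => (hρ.neg ht).le)
    · by_contra! h
      exact hPΩ (by rw [hΩU]; exact ⟨hcl hPcl, h⟩)
  set D := fderiv ℝ ρ P with hD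
  have hDρ : HasFDerivAt ρ D P := hdiff.hasFDerivAt
  -- `ρ` is invariant under the reflection `S`, which fixes `P`, so only `∂ρ/∂x_j` can be nonzero
  set S : (Fin n → ℂ) →L[ℝ] (Fin n → ℂ) := ContinuousLinearMap.pi fun i =>
    if i = j then (Complex.conjCLE : ℂ →L[ℝ] ℂ) ∘L ContinuousLinearMap.proj j
    else -ContinuousLinearMap.proj i with hS
  have hSj : ∀ z, S z j = (starRingEnd ℂ) (z j) := fun z => by simp [hS]
  have hSi : ∀ z i, i ≠ j → S z i = -z i := fun z i hi => by simp [hS, hi]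
  have hSP : S P = P := by
    ext i
    by_cases hi : i = j
    · subst hi; rw [hSj]; simp [hP]
    · rw [hSi _ _ hi]; simp [hP, Pi.single_eq_of_ne hi]
  have hSD : D ∘L S = D := by
    have h1 : HasFDerivAt (ρ ∘ S) (D ∘L S) P := by
      refine HasFDerivAt.comp P ?_ S.hasFDerivAt
      rwa [hSP]
    have h2 : ρ ∘ S =ᶠ[𝓝 P] ρ := by
      have hU1 := hU.mem_nhds (hcl hPcl)
      have hU2 : ∀ᶠ z in 𝓝 P, S z ∈ U := by
        have := S.continuous.tendsto P
        rw [hSP] at this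
        exact this.eventually hU1
      filter_upwards [hU1, hU2] with z h1 h2
      refine hrad _ h2 _ h1 fun i => ?_
      by_cases hi : i = j
      · subst hi; rw [hSj, RCLike.norm_conj]
      · rw [hSi _ _ hi, norm_neg]
    exact (h1.congr_of_eventuallyEq h2.symm).unique hDρ
  set κ := D e with hκ
  have hDv : ∀ v, D v = κ * (v j).re := fun v => by
    set v' := v - (v j).re • e with hv'
    have h1 : S v' = -v' := by
      ext i
      by_cases hi : i = j
      · subst hi
        rw [hSj]
        apply Complex.ext <;> simp [hv', he]
      · rw [hSi _ _ hi]; rfl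
    have h2 : D v' = 0 := by
      have := DFunLike.congr_fun hSD v'
      simp only [ContinuousLinearMap.comp_apply, h1, map_neg] at this
      linarith
    have h3 : v = v' + (v j).re • e := by simp [hv']
    conv_lhs => rw [h3]
    rw [map_add, h2, map_smul, smul_eq_mul, zero_add, mul_comm]
  have hκ0 : κ ≠ 0 := fun h => by
    apply hρ.fderiv_ne_zero P hPfr
    ext v
    rw [← hD, hDv, h, zero_mul]
    rfl
  have hlo : ∀ᶠ z in 𝓝 P, |ρ z - κ * (z j - P j).re| ≤ |κ| / 6 * ‖z - P‖ := by
    have := hDρ.isLittleO.def (show 0 < |κ| / 6 by positivity)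
    filter_upwards [this] with z hz
    rwa [hρP, sub_zero, hDv, Pi.sub_apply, Real.norm_eq_abs] at hz
  have hen : ‖e‖ = 1 := by simp [he, Pi.norm_single]
  have hκpos : 0 < κ := by
    by_contra! hneg
    obtain ⟨t, ⟨h1, h2⟩, h3⟩ := ((hin.and (hpath.eventually hlo)).and
      (self_mem_nhdsWithin : Set.Ioi (0 : ℝ) ∈ 𝓝[>] 0)).exists
    have ht : 0 < t := h3
    have h4 := hρ.neg h1
    have h5 : (P + (-t) • e) j - P j = ((-t : ℝ) : ℂ) := by simp [he]
    rw [h5, add_sub_cancel_left, norm_smul, hen, Complex.ofReal_re, Real.norm_eq_abs, abs_neg,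
      abs_of_pos ht, abs_of_nonpos hneg] at h2
    have h6 := (abs_le.1 h2).1
    have h7 : κ * t < 0 := mul_neg_of_neg_of_pos (lt_of_le_of_ne hneg hκ0) ht
    nlinarith
  rw [abs_of_pos hκpos] at hlo
  refine ⟨κ / 4, by positivity, ?_⟩
  obtain ⟨ε, hε, hball⟩ := Metric.eventually_nhds_iff.1 (hlo.and (hU.mem_nhds (hcl hPcl)))
  filter_upwards [Ioo_mem_nhdsGT (show 0 < ε / 2 by positivity)] with δ ⟨hδ, hδε⟩ z hz
  rw [← hPt, Metric.mem_closedBall, dist_eq_norm] at hz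
  have hzj : ‖z j - ((R - δ : ℝ) : ℂ)‖ ≤ δ / 2 := by
    have := (norm_le_pi_norm (z - (P + (-δ) • e)) j).trans hz
    rwa [hPt, Pi.sub_apply, Pi.single_eq_same] at this
  have hre := abs_le.1 ((Complex.abs_re_le_norm _).trans hzj)
  simp only [Complex.sub_re, Complex.ofReal_re] at hre
  have hzP : ‖z - P‖ ≤ 3 * δ / 2 := by
    have e1 : z - P = (z - (P + (-δ) • e)) + (-δ) • e := by abel
    rw [e1]
    refine (norm_add_le _ _).trans ?_
    rw [norm_smul, hen, Real.norm_eq_abs, abs_neg, abs_of_pos hδ]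
    linarith
  obtain ⟨h1, h2⟩ := hball (y := z) (by rw [dist_eq_norm]; linarith)
  have h3 := (abs_le.1 h1).2
  have h4 : (z j - P j).re ≤ -(δ / 2) := by
    simp only [hP, Pi.single_eq_same, Complex.sub_re, Complex.ofReal_re]
    linarith [hre.2]
  have h5 : κ * (z j - P j).re ≤ κ * -(δ / 2) := by gcongr
  have h6 : κ / 6 * ‖z - P‖ ≤ κ / 6 * (3 * δ / 2) := by gcongr
  have h7 : κ / 4 * δ ≤ -ρ z := by linarith
  have h8 : 0 < κ / 4 * δ := by positivity
  refine ⟨?_, h7, ?_⟩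
  · rw [hΩU]
    exact ⟨h2, by linarith⟩
  · linarith [Complex.re_le_norm (z j), hre.1]

/-! ### Moments of the exponential weight -/

/-- The upper bound for the moments: `(‖z j‖ / R) ^ s` decays like `exp (-s * x)` and the weight like
`exp (-k / x)` in `x = 1 - ‖z j‖ / R`, and `s * x + k / x` is at least a multiple of `√s`. -/
theorem IsMultiRadialDefiningFunction.exists_coordMoment_le {n : ℕ} {Ω : Set (Fin n → ℂ)}
    {ρ : (Fin n → ℂ) → ℝ} (hΩ : IsCompleteReinhardtDomain Ω) (hb : Bornology.IsBounded Ω)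
    (hρ : IsMultiRadialDefiningFunction Ω ρ) {j : Fin n} {R : ℝ} (hR0 : 0 < R)
    (hR : ∀ z ∈ Ω, ‖z j‖ < R) :
    ∃ a : ℝ, 0 < a ∧ ∃ c : ℝ, ∀ᶠ s in atTop,
      coordMoment Ω (fun z => Real.exp (1 / ρ z)) j s ≤ R ^ s * Real.exp (c - a * √s) := by
  obtain ⟨M, hM0, hM⟩ := hρ.exists_neg_le_mul_sub hΩ hb hR
  have hw := hρ.isWeight
  have hm := hΩ.isOpen.measurableSet
  have hvol : volume Ω ≠ ⊤ := hb.measure_lt_top.ne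
  have hv0 : 0 < volume.real Ω :=
    ENNReal.toReal_pos (hΩ.isOpen.measure_pos volume hΩ.isConnected.nonempty).ne' hvol
  refine ⟨√(1 / (M * R)), by positivity, Real.log (volume.real Ω), ?_⟩
  filter_upwards [eventually_gt_atTop 0] with s hs
  set B : ℝ := R ^ s * Real.exp (-(√(1 / (M * R)) * √s)) with hB
  have hbound : ∀ z ∈ Ω, ‖Real.exp (1 / ρ z) * ‖z j‖ ^ s‖ ≤ B := by
    intro z hz
    rw [Real.norm_of_nonneg (by positivity)]
    set x := (R - ‖z j‖) / R with hx
    have hx0 : 0 < x := div_pos (sub_pos.2 (hR z hz)) hR0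
    have hzx : ‖z j‖ = R * (1 - x) := by rw [hx]; field_simp; ring
    have h1x : 0 ≤ 1 - x := by
      have : 0 ≤ R * (1 - x) := hzx ▸ norm_nonneg _
      exact nonneg_of_mul_nonneg_right this hR0
    have hexp : ‖z j‖ ^ s ≤ R ^ s * Real.exp (-(s * x)) := by
      rw [hzx, Real.mul_rpow hR0.le h1x]
      gcongr
      calc (1 - x) ^ s ≤ Real.exp (-x) ^ s := by
            gcongr
            linarith [Real.add_one_le_exp (-x)]
        _ = _ := by rw [← Real.exp_mul]; congr 1; ring
    have hwt : 1 / ρ z ≤ -(1 / (M * R) / x) := by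
      have h1 := hM z hz
      have h2 : M * (R - ‖z j‖) = M * R * x := by rw [hx]; field_simp
      have h3 : 0 < -ρ z := neg_pos.2 (hρ.neg hz)
      have h4 : 1 / (M * R * x) ≤ 1 / -ρ z := one_div_le_one_div_of_le h3 (h2 ▸ h1)
      rw [div_div, ← neg_neg (ρ z), one_div_neg_eq_neg_one_div]
      exact neg_le_neg h4
    -- the inequality between the arithmetic and the geometric mean
    have hamgm : √(1 / (M * R)) * √s ≤ s * x + 1 / (M * R) / x := by
      rw [← Real.sqrt_mul (by positivity)]
      have hk : 0 < 1 / (M * R) := by positivity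
      refine Real.sqrt_le_iff.2 ⟨by positivity, ?_⟩
      have : 1 / (M * R) * s = (s * x) * (1 / (M * R) / x) := by field_simp
      rw [this]
      have h1 : 0 ≤ s * x := by positivity
      have h2 : 0 ≤ 1 / (M * R) / x := by positivity
      nlinarith
    calc Real.exp (1 / ρ z) * ‖z j‖ ^ s
        ≤ Real.exp (-(1 / (M * R) / x)) * (R ^ s * Real.exp (-(s * x))) := by gcongr
      _ = R ^ s * Real.exp (-(s * x + 1 / (M * R) / x)) := by
          rw [neg_add, Real.exp_add]; ring
      _ ≤ B := by rw [hB]; gcongr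
  have hint : coordMoment Ω (fun z => Real.exp (1 / ρ z)) j s =
      ∫ z in Ω, Real.exp (1 / ρ z) * ‖z j‖ ^ s := by
    rw [coordMoment, weightedMeasure, integral_withDensity_eq_integral_toReal_smul₀]
    · simp [ENNReal.toReal_ofReal, (Real.exp_pos _).le]
    · exact (hw.continuousOn.aemeasurable hm).ennreal_ofReal
    · exact ae_of_all _ fun _ => ENNReal.ofReal_lt_top
  rw [hint]
  refine (Real.le_norm_self _).trans
    ((norm_setIntegral_le_of_norm_le_const hvol.lt_top hbound).trans_eq ?_)
  rw [hB, sub_eq_add_neg, Real.exp_add, Real.exp_log hv0]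
  ring

/-- The lower bound for the moments, from a ball at distance `R / √s` from the boundary point on the
`j`-th axis. -/
theorem IsMultiRadialDefiningFunction.exists_le_coordMoment {n : ℕ} {Ω : Set (Fin n → ℂ)}
    {ρ : (Fin n → ℂ) → ℝ} (hΩ : IsOpen Ω) (hb : Bornology.IsBounded Ω)
    (hρ : IsMultiRadialDefiningFunction Ω ρ) {j : Fin n} {R : ℝ} (hR0 : 0 < R)
    (hR : ∀ z ∈ Ω, ‖z j‖ < R)
    (hsingle : ∀ r : ℝ, 0 ≤ r → r < R → (Pi.single j (r : ℂ) : Fin n → ℂ) ∈ Ω) :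
    ∃ b : ℝ, ∀ᶠ s in atTop,
      R ^ s * Real.exp (-(b * √s)) ≤ coordMoment Ω (fun z => Real.exp (1 / ρ z)) j s := by
  have hm := hΩ.measurableSet
  have := hρ.isFiniteMeasure hΩ hb
  obtain ⟨κ, hκ, hκδ⟩ := hρ.exists_closedBall_subset hR0 hR hsingle
  set V : ℝ := volume.real (Metric.ball (0 : Fin n → ℂ) 1) with hV
  have hV0 : 0 < V := ENNReal.toReal_pos (Metric.measure_ball_pos volume _ one_pos).ne'
    measure_ball_lt_top.ne
  set d := Module.finrank ℝ (Fin n → ℂ) with hd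
  have hc0 : 0 < V * (R / 2) ^ d := by positivity
  have hsq : Tendsto (fun x : ℝ => √x) atTop atTop := Real.tendsto_sqrt_atTop
  -- the balls of radius `R / (2 * √s)` balance the decay of `‖z j‖ ^ s` and of the weight
  have hδ : Tendsto (fun s : ℝ => R / √s) atTop (𝓝[>] 0) := by
    refine tendsto_nhdsWithin_iff.2 ⟨hsq.const_div_atTop R, ?_⟩
    filter_upwards [eventually_gt_atTop 0] with s hs
    have : 0 < √s := Real.sqrt_pos.2 hs
    exact div_pos hR0 this
  have hpoly := hsq.eventually
    ((Real.tendsto_pow_mul_exp_neg_atTop_nhds_zero d).eventually (ge_mem_nhds hc0))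
  refine ⟨4 + 1 / (κ * R) + 1, ?_⟩
  filter_upwards [hδ.eventually hκδ, hpoly, hsq.eventually_ge_atTop 4,
    eventually_gt_atTop 0] with s h1 h2 h3 hs
  set y := √s with hy
  have hy0 : 0 < y := by linarith
  have hys : y * y = s := Real.mul_self_sqrt hs.le
  set B := Metric.closedBall (Pi.single j ((R - R / y : ℝ) : ℂ) : Fin n → ℂ) (R / y / 2) with hB
  have hBΩ : B ⊆ Ω := fun z hz => (h1 z hz).1
  have hBm : MeasurableSet B := Metric.isClosed_closedBall.measurableSet
  have hlow : 0 ≤ R - 2 * (R / y) := by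
    have : R / y ≤ R / 4 := by gcongr
    linarith
  have hmark := mul_meas_ge_le_integral_of_nonneg
    (μ := weightedMeasure Ω fun z => Real.exp (1 / ρ z))
    (ae_of_all _ fun z => by positivity : 0 ≤ᵐ[_] fun z : Fin n → ℂ => ‖z j‖ ^ s)
    (integrable_coord_rpow hm hb j hs.le) ((R - 2 * (R / y)) ^ s)
  have hsub : (weightedMeasure Ω fun z => Real.exp (1 / ρ z)).real B ≤
      (weightedMeasure Ω fun z => Real.exp (1 / ρ z)).real
        {z | (R - 2 * (R / y)) ^ s ≤ ‖z j‖ ^ s} := by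
    refine measureReal_mono fun z hz => ?_
    exact Real.rpow_le_rpow hlow (h1 z hz).2.2 hs.le
  have hvol : volume.real B = (R / y / 2) ^ d * V := by
    rw [hB, hV, measureReal_def, Measure.addHaar_closedBall _ _ (by positivity), ENNReal.toReal_mul,
      ENNReal.toReal_ofReal (by positivity), measureReal_def]
  have hwB : Real.exp (-(1 / (κ * R) * y)) * volume.real B ≤
      (weightedMeasure Ω fun z => Real.exp (1 / ρ z)).real B := by
    rw [measureReal_def, measureReal_def,
      ← ENNReal.toReal_ofReal (Real.exp_pos (-(1 / (κ * R) * y))).le, ← ENNReal.toReal_mul]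
    refine ENNReal.toReal_mono (measure_ne_top _ _) ?_
    rw [weightedMeasure, withDensity_apply _ hBm, Measure.restrict_restrict hBm,
      Set.inter_eq_left.2 hBΩ, ← setLIntegral_const]
    refine setLIntegral_mono' hBm fun z hz => ENNReal.ofReal_le_ofReal (Real.exp_le_exp.2 ?_)
    have h4 := (h1 z hz).2.1
    have h5 : 0 < κ * (R / y) := by positivity
    have h6 := one_div_le_one_div_of_le h5 h4
    rw [one_div_neg_eq_neg_one_div] at h6
    have h7 : 1 / (κ * (R / y)) = 1 / (κ * R) * y := by field_simp
    linarith
  have hpow : R ^ s * Real.exp (-(4 * y)) ≤ (R - 2 * (R / y)) ^ s := by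
    have e1 : R - 2 * (R / y) = R * (1 - 2 / y) := by field_simp
    have h2y : 2 / y ≤ 1 / 2 := by rw [div_le_div_iff₀ hy0 two_pos]; linarith
    have h2y0 : 0 < 2 / y := by positivity
    -- `exp (-2 t) ≤ 1 - t` for `t = 2 / y ≤ 1 / 2`
    have e2 : Real.exp (-(4 / y)) ≤ 1 - 2 / y := by
      have h5 := Real.add_one_le_exp (4 / y)
      have h6 : 4 / y = 2 * (2 / y) := by ring
      rw [Real.exp_neg, inv_le_iff_one_le_mul₀ (Real.exp_pos _)]
      nlinarith
    rw [e1, Real.mul_rpow hR0.le (by linarith)]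
    gcongr
    calc Real.exp (-(4 * y)) = Real.exp (-(4 / y)) ^ s := by
          rw [← Real.exp_mul, ← hys]; congr 1; field_simp
      _ ≤ _ := by gcongr
  have hexp : Real.exp (-y) ≤ volume.real B := by
    rw [hvol, div_right_comm, div_pow, div_mul_eq_mul_div, le_div_iff₀ (by positivity)]
    linarith
  calc R ^ s * Real.exp (-((4 + 1 / (κ * R) + 1) * y))
      = (R ^ s * Real.exp (-(4 * y))) * (Real.exp (-(1 / (κ * R) * y)) * Real.exp (-y)) := by
        rw [mul_assoc, ← Real.exp_add, ← Real.exp_add]; congr 2; ring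
    _ ≤ (R - 2 * (R / y)) ^ s * (Real.exp (-(1 / (κ * R) * y)) * volume.real B) := by gcongr
    _ ≤ (R - 2 * (R / y)) ^ s * _ :=
        mul_le_mul_of_nonneg_left (hwB.trans hsub) (Real.rpow_nonneg hlow _)
    _ ≤ _ := hmark

/-! ### The dilation inequality -/

/-- Strict concavity of `x ↦ √x` at the weights `1 / p` and `1 / q`. -/
theorem Real.HolderConjugate.inv_sqrt_add_inv_sqrt_lt {p q : ℝ} (hpq : p.HolderConjugate q)
    (hp : p ≠ 2) : √(1 / p) + √(1 / q) < √2 := by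
  have hp0 := hpq.pos
  have hq0 := hpq.symm.pos
  have hsum : 1 / p + 1 / q = 1 := by simpa using hpq.inv_add_inv_eq_one
  have hne : √(1 / p) ≠ √(1 / q) := by
    intro h
    rw [Real.sqrt_inj (by positivity) (by positivity)] at h
    apply hp
    rw [← h] at hsum
    field_simp at hsum
    linarith
  apply Real.lt_sqrt_of_sq_lt
  have h1 := Real.sq_sqrt (by positivity : 0 ≤ 1 / p)
  have h2 := Real.sq_sqrt (by positivity : 0 ≤ 1 / q)
  nlinarith [sq_pos_of_ne_zero (sub_ne_zero.2 hne)]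

/-- A monotone function of the exact order `√s` cannot satisfy the dilation inequality
`G (2 m) ≤ G (p m) / p + G (q m) / q + C` unless `p = q = 2`: because `√(1 / p) + √(1 / q) < √2`,
the inequality improves every bound `G s ≤ β * √s` by a fixed factor less than one. -/
theorem false_of_dilation_inequality {p q : ℝ} (hpq : p.HolderConjugate q) (hp : p ≠ 2)
    {G : ℝ → ℝ} (hG : MonotoneOn G (Set.Ioi 0)) {a b c C : ℝ} (ha : 0 < a)
    (hlow : ∀ᶠ s in atTop, a * √s - c ≤ G s) (hup : ∀ᶠ s in atTop, G s ≤ b * √s)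
    (hdil : ∀ᶠ m : ℕ in atTop, G (m * 2) ≤ G (m * p) / p + G (m * q) / q + C) : False := by
  have hp0 := hpq.pos
  have hq0 := hpq.symm.pos
  set κ := √(1 / p) + √(1 / q) with hκ
  have hκ0 : 0 < κ := by positivity
  have hs2 : (0 : ℝ) < √2 := by positivity
  obtain ⟨θ, hθ1, hθ2⟩ := exists_between ((div_lt_one hs2).2 (hpq.inv_sqrt_add_inv_sqrt_lt hp))
  have hθ0 : 0 < θ := lt_trans (by positivity) hθ1
  rw [div_lt_iff₀ hs2] at hθ1
  have hsq : Tendsto (fun x : ℝ => √x) atTop atTop := Real.tendsto_sqrt_atTop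
  have step : ∀ β : ℝ, 0 < β → (∀ᶠ s in atTop, G s ≤ β * √s) →
      ∀ᶠ s in atTop, G s ≤ θ * β * √s := by
    intro β hβ hev
    have hceil : Tendsto (fun x : ℝ => ⌈x⌉₊) atTop atTop := tendsto_nat_ceil_atTop
    have hpt : Tendsto (fun m : ℕ => (m : ℝ) * p) atTop atTop :=
      tendsto_natCast_atTop_atTop.atTop_mul_const hp0
    have hqt : Tendsto (fun m : ℕ => (m : ℝ) * q) atTop atTop :=
      tendsto_natCast_atTop_atTop.atTop_mul_const hq0
    have hmain : ∀ᶠ x : ℝ in atTop, G (x * 2) ≤ θ * β * √(x * 2) := by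
      have hgap : 0 < β * (θ * √2 - κ) := mul_pos hβ (by linarith)
      filter_upwards [hceil.eventually hdil, hceil.eventually (hpt.eventually hev),
        hceil.eventually (hqt.eventually hev), eventually_gt_atTop 0,
        hsq.eventually_ge_atTop ((β * κ + C) / (β * (θ * √2 - κ)))] with x h1 h2 h3 hx h4
      set m : ℝ := (⌈x⌉₊ : ℝ)
      have hxm : x ≤ m := Nat.le_ceil x
      have hmx : m < x + 1 := Nat.ceil_lt_add_one hx.le
      have hm0 : 0 < m := hx.trans_le hxm
      rw [div_le_iff₀ hgap] at h4
      have hsm : √m ≤ √x + 1 := by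
        rw [Real.sqrt_le_left (by positivity)]
        nlinarith [Real.sq_sqrt hx.le, Real.sqrt_nonneg x]
      have hdiv : ∀ r : ℝ, 0 < r → β * √(m * r) / r = β * √m * √(1 / r) := fun r hr => by
        rw [Real.sqrt_mul hm0.le, one_div, Real.sqrt_inv]
        have := Real.mul_self_sqrt hr.le
        have h0 : √r ≠ 0 := by positivity
        field_simp
        linear_combination this
      calc G (x * 2) ≤ G (m * 2) :=
            hG (by simpa using hx) (by simpa using hm0) (by linarith)
        _ ≤ G (m * p) / p + G (m * q) / q + C := h1
        _ ≤ β * √(m * p) / p + β * √(m * q) / q + C := by gcongr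
        _ = β * κ * √m + C := by rw [hdiv p hp0, hdiv q hq0, hκ]; ring
        _ ≤ β * κ * (√x + 1) + C := by gcongr
        _ ≤ θ * β * (√x * √2) := by nlinarith
        _ = θ * β * √(x * 2) := by rw [Real.sqrt_mul hx.le]
    have hhalf : Tendsto (fun s : ℝ => s / 2) atTop atTop :=
      tendsto_id.atTop_div_const two_pos
    filter_upwards [hhalf.eventually hmain] with s hs
    simpa using hs
  set B := max b 1
  have hB : 0 < B := lt_max_of_lt_right one_pos
  have iter : ∀ k : ℕ, ∀ᶠ s in atTop, G s ≤ θ ^ k * B * √s := by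
    intro k
    induction k with
    | zero =>
      filter_upwards [hup] with s hs
      refine hs.trans ?_
      rw [pow_zero, one_mul]
      exact mul_le_mul_of_nonneg_right (le_max_left _ _) (Real.sqrt_nonneg s)
    | succ k ih =>
      filter_upwards [step _ (by positivity) ih] with s hs
      rwa [pow_succ', mul_assoc θ]
  obtain ⟨k, hk⟩ := exists_pow_lt_of_lt_one (show 0 < a / (2 * B) by positivity) hθ2
  rw [lt_div_iff₀ (by positivity)] at hk
  obtain ⟨s, h1, h2, h3⟩ := ((iter k).and (hlow.and
    (hsq.eventually_gt_atTop (2 * c / a)))).exists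
  rw [div_lt_iff₀ ha] at h3
  nlinarith [Real.sqrt_nonneg s]

/-! ### Boundedness of the projection -/

/-- Orthogonal projections are contractions of `L²`. -/
theorem isBoundedOnLp_two_bergmanProjection {n : ℕ} {Ω : Set (Fin n → ℂ)} {w : (Fin n → ℂ) → ℝ}
    (h : IsWeight Ω w) : IsBoundedOnLp (bergmanProjection h) 2 := by
  have : CompleteSpace (bergmanSpace Ω w) := (isClosed_bergmanSpace h).completeSpace_coe
  refine ⟨1, fun f _ => ?_⟩
  rw [← Lp.enorm_def, ← Lp.enorm_def, ENNReal.coe_one, one_mul, enorm_le_iff_norm_le]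
  exact (bergmanSpace Ω w).norm_starProjection_apply_le f

theorem antitoneOn_coordMoment_div_rpow {n : ℕ} {Ω : Set (Fin n → ℂ)} {w : (Fin n → ℂ) → ℝ}
    [IsFiniteMeasure (weightedMeasure Ω w)] (hΩ : MeasurableSet Ω) (hb : Bornology.IsBounded Ω)
    {j : Fin n} {R : ℝ} (hR0 : 0 < R) (hR : ∀ z ∈ Ω, ‖z j‖ < R) :
    AntitoneOn (fun s => coordMoment Ω w j s / R ^ s) (Set.Ioi 0) := by
  intro s hs t ht hst
  have e : ∀ r : ℝ, coordMoment Ω w j r / R ^ r = ∫ z, (‖z j‖ / R) ^ r ∂weightedMeasure Ω w := by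
    intro r
    rw [coordMoment, ← integral_div]
    congr 1
    ext z
    rw [Real.div_rpow (norm_nonneg _) hR0.le]
  have hi : ∀ r : ℝ, 0 < r →
      Integrable (fun z : Fin n → ℂ => (‖z j‖ / R) ^ r) (weightedMeasure Ω w) := fun r hr => by
    simp only [Real.div_rpow (norm_nonneg _) hR0.le]
    exact (integrable_coord_rpow hΩ hb j hr.le).div_const _
  simp only [e]
  refine integral_mono_ae (hi t ht) (hi s hs) ((ae_mem_weightedMeasure w hΩ).mono fun z hz => ?_)
  exact Real.rpow_le_rpow_of_exponent_ge_of_imp (by positivity)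
    ((div_le_one hR0).2 (hR z hz).le) hst fun _ h => absurd h (Set.mem_Ioi.1 ht).ne'

theorem theorem1 (n : ℕ) (hn : 2 ≤ n) (Ω : Set (Fin n → ℂ)) (ρ : (Fin n → ℂ) → ℝ)
    (hΩ : IsCompleteReinhardtDomain Ω) (hΩb : Bornology.IsBounded Ω)
    (hρ : IsMultiRadialDefiningFunction Ω ρ) (p : ℝ≥0∞) (hp1 : 1 < p) (hp : p < ⊤) :
    IsBoundedOnLp (bergmanProjection hρ.isWeight) p ↔ p = 2 := by
  constructor
  swap
  · rintro rfl
    exact isBoundedOnLp_two_bergmanProjection _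
  intro hB
  by_contra hp2
  obtain ⟨P, rfl⟩ : ∃ P : ℝ, p = ENNReal.ofReal P :=
    ⟨p.toReal, (ENNReal.ofReal_toReal hp.ne).symm⟩
  have hP1 : 1 < P := by
    rw [← ENNReal.ofReal_one, ENNReal.ofReal_lt_ofReal_iff'] at hp1
    exact hp1.1
  have hP2 : P ≠ 2 := fun h => hp2 (by simp [h])
  have hpq := Real.HolderConjugate.conjExponent hP1
  set Q := P.conjExponent
  have hm := hΩ.isOpen.measurableSet
  have := hρ.isFiniteMeasure hΩ.isOpen hΩb
  have j : Fin n := ⟨0, by omega⟩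
  obtain ⟨R, hR0, hR, hsingle⟩ := hΩ.exists_radius hΩb j
  obtain ⟨C, hC⟩ :=
    coordMoment_mul_le_of_isBoundedOnLp hΩ hΩb (hρ.isTorusInvariant hΩ) hρ.isWeight hpq hB j
  obtain ⟨a, ha, c, hup⟩ := hρ.exists_coordMoment_le hΩ hΩb hR0 hR
  obtain ⟨b, hlow⟩ := hρ.exists_le_coordMoment hΩ.isOpen hΩb hR0 hR hsingle
  set A := coordMoment Ω (fun z => Real.exp (1 / ρ z)) j
  have hRs : ∀ s : ℝ, 0 < R ^ s := fun s => Real.rpow_pos_of_pos hR0 s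
  have hev : ∀ᶠ s in atTop, 0 < A s := hlow.mono fun s hs =>
    (mul_pos (hRs s) (Real.exp_pos _)).trans_le hs
  have hanti := antitoneOn_coordMoment_div_rpow (w := fun z => Real.exp (1 / ρ z)) hm hΩb hR0 hR
  have hpos : ∀ s : ℝ, 0 < s → 0 < A s / R ^ s := by
    intro s hs
    obtain ⟨t, h1, h2⟩ := (hev.and (eventually_ge_atTop s)).exists
    exact (div_pos h1 (hRs t)).trans_le (hanti hs (hs.trans_le h2) h2)
  have hA : ∀ s : ℝ, 0 < s → 0 < A s := fun s hs => by
    simpa [(hRs s).ne'] using mul_pos (hpos s hs) (hRs s)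
  refine false_of_dilation_inequality hpq hP2 (G := fun s => -Real.log (A s / R ^ s)) (a := a)
    (b := b) (c := c) (C := Real.log C) ?_ ha ?_ ?_ ?_
  · intro s hs t ht hst
    exact neg_le_neg (Real.log_le_log (hpos t ht) (hanti hs ht hst))
  · filter_upwards [hup, eventually_gt_atTop 0] with s h1 hs
    have : Real.log (A s / R ^ s) ≤ c - a * √s := by
      rw [Real.log_le_iff_le_exp (hpos s hs), div_le_iff₀' (hRs s)]
      exact h1
    linarith
  · filter_upwards [hlow, eventually_gt_atTop 0] with s h1 hs
    have : -(b * √s) ≤ Real.log (A s / R ^ s) := by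
      rw [Real.le_log_iff_exp_le (hpos s hs), le_div_iff₀' (hRs s)]
      exact h1
    linarith
  · filter_upwards [eventually_ne_atTop 0] with m hm0
    have hmpos : (0 : ℝ) < m := by positivity
    have hAp := hA _ (mul_pos hmpos hpq.pos)
    have hAq := hA _ (mul_pos hmpos hpq.symm.pos)
    have hA2 := hA _ (mul_pos hmpos two_pos)
    have h1 := hC m hm0 hAp hAq
    have hC0 : 0 < C := by
      have : 0 < C * A (m * 2) := lt_of_lt_of_le (by positivity) h1
      exact pos_of_mul_pos_left this hA2.le
    have h2 := Real.log_le_log (by positivity) h1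
    rw [Real.log_mul (by positivity) (by positivity), Real.log_rpow hAp, Real.log_rpow hAq,
      Real.log_mul hC0.ne' hA2.ne'] at h2
    have hlog : ∀ s : ℝ, 0 < A s → Real.log (A s / R ^ s) = Real.log (A s) - s * Real.log R :=
      fun s hs => by rw [Real.log_div hs.ne' (hRs s).ne', Real.log_rpow hR0]
    simp only [hlog _ hAp, hlog _ hAq, hlog _ hA2]
    have h3 : ∀ r : ℝ, r ≠ 0 → ∀ x : ℝ, -(x - m * r * Real.log R) / r =
        m * Real.log R - 1 / r * x := fun r hr x => by field_simp; ring
    rw [h3 P hpq.ne_zero, h3 Q hpq.symm.ne_zero]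
    linarith
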